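/- **Setting.** Let $F:\mathbb{R}^n\to\mathbb{R}^n$ be continuously differentiable, let $g_1,\dots,g_m:\mathbb{R}^n\to\mathbb{R}$ be convex and continuously differentiable with locally Lipschitz gradients (for instance, convex and $C^2$), let $h(x)=Hx-c$ with $H\in\mathbb{R}^{k\times n}$, $c\in\mathbb{R}^k$, and let $$\mathcal{C}=\{x\in\mathbb{R}^n : g(x)\le 0,\ h(x)=0\},$$ which is a closed convex set. Let $\mathrm{SOL}(F,\mathcal{C})$ be the set of $x^*\in\mathcal{C}$ with $(x-x^*)^\top F(x^*)\ge 0$ for all $x\in\mathcal{C}$, and write $I_0(x)=\{i : g_i(x)=0\}$. *MFCQ* holds at $x\in\mathcal{C}$ if $\nabla h_1(x),\dots,\nabla h_k(x)$ are linearly independent and there is $\xi\in\mathbb{R}^n$ with $\nabla g_i(x)^\top\xi<0$ for all $i\in I_0(x)$ and $\nabla h_j(x)^\top\xi=0$ for all $j$. The *constant-rank condition* holds at $x\in\mathcal{C}$ if there is an open set $U\ni x$ such that for every $I\subset I_0(x)$ the rank of $\{\nabla g_i(y)\}_{i\in I}\cup\{\nabla h_j(y)\}_{j=1}^k$ is constant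 for $y\in U$. Fix $\alpha>0$. For $x\in\mathbb{R}^n$ put $\mathcal{F}(x,u,v)=-F(x)-\sum_i u_i\nabla g_i(x)-\sum_j v_j\nabla h_j(x)$, let $K_\alpha(x)$ be the set of $(u,v)\in\mathbb{R}^m_{\ge0}\times\mathbb{R}^k$ such that $\xi=\mathcal{F}(x,u,v)$ satisfies $\nabla g_i(x)^\top\xi\le-\alpha g_i(x)$ for all $i$ and $\nabla h_j(x)^\top\xi=-\alpha h_j(x)$ for all $j$. The *safe monotone flow* with parameter $\alpha$ is the system $\dot x=\mathcal{F}(x,u,v)$, where $(u,v)$ is any minimizer of $\tfrac12\|\sum_i u_i\nabla g_i(x)+\sum_j v_j\nabla h_j(x)\|^2$ over $K_\alpha(x)$. An equilibrium $x^*$ of this system is *globally Lyapunov stable* if solutions of the system exist from every initial point of $\mathbb{R}^n$ and every solution on an interval $[0,T)$ extends to $[0,\infty)$; for every $\varepsilon>0$ there is $\delta>0$ such that every solution with $\|x(0)-x^*\|<\delta$ satisfies $\|x(t)-x^*\|<\varepsilon$ for all $t\ge0$; and for every $r$ there is $R$ such that every solution with $\|x(0)-x^*\|\le r$ satisfies $\|x(t)-x^*\|\le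 R$ for all $t\ge0$. It is *globally asymptotically stable* if, in addition, every solution on $[0,\infty)$ converges to $x^*$ as $t\to\infty$. **Theorem (Stability of the safe monotone flow with respect to $\mathbb{R}^n$).** Assume that MFCQ and the constant-rank condition hold at every point of $\mathcal{C}$, and let $\alpha>0$. 1. If $x^*\in\mathrm{SOL}(F,\mathcal{C})$ and $F$ is monotone, i.e. $(x_1-x_2)^\top(F(x_1)-F(x_2))\ge0$ for all $x_1,x_2\in\mathbb{R}^n$, then $x^*$ is a globally Lyapunov stable equilibrium of the safe monotone flow. 2. If $x^*\in\mathrm{SOL}(F,\mathcal{C})$ and $F$ is $\mu$-strongly monotone for some $\mu>0$, i.e. $(x_1-x_2)^\top(F(x_1)-F(x_2))\ge\mu\|x_1-x_2\|^2$ for all $x_1,x_2\in\mathbb{R}^n$, then $x^*$ is a globally asymptotically stable equilibrium of the safe monotone flow. -/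

import Mathlib

open Set Filter Topology

noncomputable section

namespace SafeMonotone

/-- `ℝⁿ` with the Euclidean norm. -/
abbrev Vec (n : ℕ) := EuclideanSpace ℝ (Fin n)

variable {n m k : ℕ}

/-! ### Monotone maps, constraints and variational inequalities -/

/-- `F` is monotone: `(x₁ - x₂)ᵀ (F x₁ - F x₂) ≥ 0`. -/
def IsMonotoneMap (F : Vec n → Vec n) : Prop :=
  ∀ x₁ x₂, 0 ≤ inner ℝ (x₁ - x₂) (F x₁ - F x₂)

/-- `F` is `μ`-strongly monotone: `(x₁ - x₂)ᵀ (F x₁ - F x₂) ≥ μ ‖x₁ - x₂‖²`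
(used with `μ > 0`). -/
def IsStronglyMonotoneMap (μ : ℝ) (F : Vec n → Vec n) : Prop :=
  ∀ x₁ x₂, μ * ‖x₁ - x₂‖ ^ 2 ≤ inner ℝ (x₁ - x₂) (F x₁ - F x₂)

/-- The affine equality constraint functions `h(x) = H x - c`, component by component. -/
def affineConstraint (H : Matrix (Fin k) (Fin n) ℝ) (c : Fin k → ℝ) (j : Fin k) (x : Vec n) : ℝ :=
  (∑ l, H j l * x l) - c j

/-- The constraint set `𝒞 = {x | g(x) ≤ 0, h(x) = 0}`. -/
def constraintSet (g : Fin m → Vec n → ℝ) (h : Fin k → Vec n → ℝ) : Set (Vec n) :=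
  {x | (∀ i, g i x ≤ 0) ∧ ∀ j, h j x = 0}

/-- The solution set of the variational inequality `VI(F, C)`: points `z ∈ C` with
`(x - z)ᵀ F(z) ≥ 0` for all `x ∈ C`. -/
def SOL (F : Vec n → Vec n) (C : Set (Vec n)) : Set (Vec n) :=
  {z | z ∈ C ∧ ∀ x ∈ C, 0 ≤ inner ℝ (x - z) (F z)}

/-- The active inequality constraints at `x`. -/
def activeSet (g : Fin m → Vec n → ℝ) (x : Vec n) : Set (Fin m) :=
  {i | g i x = 0}

/-- The Mangasarian-Fromovitz constraint qualification at `x`. -/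
def MFCQ (g : Fin m → Vec n → ℝ) (h : Fin k → Vec n → ℝ) (x : Vec n) : Prop :=
  LinearIndependent ℝ (fun j => gradient (h j) x) ∧
    ∃ ξ : Vec n, (∀ i ∈ activeSet g x, inner ℝ (gradient (g i) x) ξ < 0) ∧
      ∀ j, inner ℝ (gradient (h j) x) ξ = 0

/-- The rank of the family `{∇ gᵢ(y)}_{i ∈ I} ∪ {∇ hⱼ(y)}_j`. -/
def gradientRank (g : Fin m → Vec n → ℝ) (h : Fin k → Vec n → ℝ) (I : Set (Fin m))
    (y : Vec n) : ℕ :=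
  Module.finrank ℝ (Submodule.span ℝ
    ((fun i => gradient (g i) y) '' I ∪ Set.range fun j => gradient (h j) y))

/-- The constant-rank condition at `x`: on some open set `U` containing `x`, for every set `I` of
constraints active at `x`, the rank of `{∇ gᵢ(y)}_{i ∈ I} ∪ {∇ hⱼ(y)}_j` does not depend on
`y ∈ U`. -/
def ConstantRank (g : Fin m → Vec n → ℝ) (h : Fin k → Vec n → ℝ) (x : Vec n) : Prop :=
  ∃ U : Set (Vec n), IsOpen U ∧ x ∈ U ∧
    ∀ I ⊆ activeSet g x, ∀ y ∈ U, gradientRank g h I y = gradientRank g h I x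

/-! ### The safe monotone flow -/

/-- The modification `∑ᵢ uᵢ ∇gᵢ(x) + ∑ⱼ vⱼ ∇hⱼ(x)` of the drift by the inputs `(u, v)`. -/
def inputTerm (g : Fin m → Vec n → ℝ) (h : Fin k → Vec n → ℝ) (x : Vec n)
    (u : Fin m → ℝ) (v : Fin k → ℝ) : Vec n :=
  (∑ i, u i • gradient (g i) x) + ∑ j, v j • gradient (h j) x

/-- The control-affine system `-F(x) - ∑ᵢ uᵢ ∇gᵢ(x) - ∑ⱼ vⱼ ∇hⱼ(x)`. -/
def controlField (F : Vec n → Vec n) (g : Fin m → Vec n → ℝ) (h : Fin k → Vec n → ℝ)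
    (x : Vec n) (u : Fin m → ℝ) (v : Fin k → ℝ) : Vec n :=
  -F x - inputTerm g h x u v

/-- The set of inputs `u ≥ 0`, `v`, for which the controlled velocity `ξ` satisfies
`∇gᵢ(x)ᵀ ξ ≤ -α gᵢ(x)` and `∇hⱼ(x)ᵀ ξ = -α hⱼ(x)`. -/
def Kcbf (F : Vec n → Vec n) (g : Fin m → Vec n → ℝ) (h : Fin k → Vec n → ℝ) (α : ℝ)
    (x : Vec n) : Set ((Fin m → ℝ) × (Fin k → ℝ)) :=
  {p | (∀ i, 0 ≤ p.1 i) ∧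
    (∀ i, inner ℝ (gradient (g i) x) (controlField F g h x p.1 p.2) ≤ -α * g i x) ∧
    ∀ j, inner ℝ (gradient (h j) x) (controlField F g h x p.1 p.2) = -α * h j x}

/-- The objective `J(x, u, v) = ½ ‖∑ᵢ uᵢ ∇gᵢ(x) + ∑ⱼ vⱼ ∇hⱼ(x)‖²`. -/
def inputCost (g : Fin m → Vec n → ℝ) (h : Fin k → Vec n → ℝ) (x : Vec n)
    (p : (Fin m → ℝ) × (Fin k → ℝ)) : ℝ :=
  (1 / 2) * ‖inputTerm g h x p.1 p.2‖ ^ 2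

/-- The safe monotone flow with safety parameter `α`: the velocities at `x` of the control system
closed with a minimizer of `J(x, ·)` over `Kcbf`. The minimizing input need not be unique, so this
is written as a set of velocities; no uniqueness is presupposed. -/
def safeMonotoneFlow (F : Vec n → Vec n) (g : Fin m → Vec n → ℝ) (h : Fin k → Vec n → ℝ) (α : ℝ)
    (x : Vec n) : Set (Vec n) :=
  {ξ | ∃ p ∈ Kcbf F g h α x, IsMinOn (inputCost g h x) (Kcbf F g h α x) p ∧
    ξ = controlField F g h x p.1 p.2}

/-! ### Trajectories and stability -/

/-- `x` solves `ẋ ∈ G(x)` on the set of times `S` (an interval `[0, T)` or `[0, ∞)` below). -/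
def IsSolutionOn (G : Vec n → Set (Vec n)) (x : ℝ → Vec n) (S : Set ℝ) : Prop :=
  ∀ t ∈ S, ∃ ξ ∈ G (x t), HasDerivWithinAt x ξ S t

/-- From every initial state of `ℝⁿ` there is a solution defined for all `t ≥ 0`, and every
solution on a bounded interval `[0, T)` extends to all `t ≥ 0`. -/
def ForwardComplete (G : Vec n → Set (Vec n)) : Prop :=
  (∀ x₀, ∃ x, IsSolutionOn G x (Ici 0) ∧ x 0 = x₀) ∧
    ∀ T > 0, ∀ x, IsSolutionOn G x (Ico 0 T) →
      ∃ y, IsSolutionOn G y (Ici 0) ∧ EqOn y x (Ico 0 T)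

/-- Lyapunov stability of `p`, required of all solutions. -/
def LyapunovStable (G : Vec n → Set (Vec n)) (p : Vec n) : Prop :=
  ∀ ε > 0, ∃ δ > 0, ∀ T > 0, ∀ x, IsSolutionOn G x (Ico 0 T) →
    ‖x 0 - p‖ < δ → ∀ t ∈ Ico 0 T, ‖x t - p‖ < ε

/-- Solutions starting in a given ball around `p` stay in a common ball around `p`. -/
def SolutionsBounded (G : Vec n → Set (Vec n)) (p : Vec n) : Prop :=
  ∀ r : ℝ, ∃ R : ℝ, ∀ T > 0, ∀ x, IsSolutionOn G x (Ico 0 T) →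
    ‖x 0 - p‖ ≤ r → ∀ t ∈ Ico 0 T, ‖x t - p‖ ≤ R

/-- Global Lyapunov stability (with respect to the whole of `ℝⁿ`) of the equilibrium `p`. -/
def GloballyLyapunovStable (G : Vec n → Set (Vec n)) (p : Vec n) : Prop :=
  0 ∈ G p ∧ ForwardComplete G ∧ LyapunovStable G p ∧ SolutionsBounded G p

/-- Global asymptotic stability (with respect to the whole of `ℝⁿ`) of the equilibrium `p`. -/
def GloballyAsymptoticallyStable (G : Vec n → Set (Vec n)) (p : Vec n) : Prop :=
  GloballyLyapunovStable G p ∧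
    ∀ x, IsSolutionOn G x (Ici 0) → Tendsto x atTop (𝓝 p)

end SafeMonotone

end

open Set Filter Topology

noncomputable section

namespace SafeMonotone

/-! ### Existence of solutions for bounded continuous vector fields -/

section Peano

variable {E : Type*} [NormedAddCommGroup E] [NormedSpace ℝ E]

/-! The flow is a single continuous vector field. MFCQ at the given solution of the variational
inequality yields a Slater point `z`, by moving slightly along the MFCQ direction. By convexity, for
every `x` in the whole space, `α • (z - x)` satisfies the velocity constraints at `x`, strictly in
the inequalities. Hence the polyhedron of feasible velocities is never empty, the projection `ξ(x)`
of `-F x` onto it is continuous in `x`, and Farkas' lemma supplies its KKT multipliers. Since the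
cost is half the squared distance from the velocity to `-F x`, every minimizing input produces this
one velocity (`safeMonotoneFlow_eq`).

For stability, let `W(x)` be the minimum of `⟪F x, ζ⟫ + ½‖ζ‖²` over feasible `ζ`. Testing the
projection against `α • (p - x)` bounds the derivative of `½‖x - p‖²` by `-⟪x - p, F x⟫ - (W +
½‖ξ‖²)/α` (`inner_sub_flowField_le`). The last term has the wrong sign where `W + ½‖ξ‖² < 0`, so the
energy adds `max (-W) 0 / α²`. Although `W` need not be differentiable, its lower right derivative
along solutions is at least `-α (W + ½‖ξ‖²)` (`eventually_flowValue_ge`). The multipliers at time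
`t` are frozen: the dual function they define lies below `W` and touches it at `x t`, and
monotonicity controls its derivative. The two contributions cancel if `W ≤ 0`; if `W > 0`, the
unwanted term is already nonpositive.

What remains is `-⟪x - p, F x - F p⟫ - ⟪x - p, F p⟫`. The first part is nonpositive by monotonicity.
The second is at most a multiplier combination of the constraints, which decays like `exp (-α t)`
and so has bounded integral (`energy_le`). The resulting bound depends continuously on `x 0` and
vanishes at `p`, giving stability and boundedness; boundedness together with Peano's theorem gives
completeness. Under strong monotonicity the energy would become negative if the solution stayed away
from `p`, so it enters every neighbourhood of `p`, and stability keeps it close. -/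

/-- The Euler scheme with step `1 / (N + 1)`. -/
def eulerSeq (G : E → E) (x₀ : E) (N : ℕ) : ℕ → E
  | 0 => x₀
  | k + 1 => eulerSeq G x₀ N k + (1 / ((N : ℝ) + 1)) • G (eulerSeq G x₀ N k)

/-- Telescoping: each step with field value within `ε` of `e` adds an error of at most `ε / (N +
1)`. With `e = 0` this becomes a Lipschitz bound in time. -/
lemma norm_eulerSeq_sub_le {G : E → E} {x₀ e : E} {N k l : ℕ} {ε : ℝ} (hkl : k ≤ l)
    (hG : ∀ i, k ≤ i → i < l → ‖G (eulerSeq G x₀ N i) - e‖ ≤ ε) :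
    ‖eulerSeq G x₀ N l - eulerSeq G x₀ N k - (((l : ℝ) - k) / (N + 1)) • e‖
      ≤ ε * (((l : ℝ) - k) / (N + 1)) := by
  induction l, hkl using Nat.le_induction with
  | base => simp
  | succ l hkl ih =>
    have h1 := ih fun i hi hil => hG i hi (hil.trans (Nat.lt_succ_self l))
    have h2 := hG l hkl (Nat.lt_succ_self l)
    have hN : (0 : ℝ) < N + 1 := by positivity
    have e1 : eulerSeq G x₀ N (l + 1) - eulerSeq G x₀ N k - ((((l + 1 : ℕ) : ℝ) - k) / (N + 1)) • e
        = (eulerSeq G x₀ N l - eulerSeq G x₀ N k - (((l : ℝ) - k) / (N + 1)) • e)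
          + (1 / ((N : ℝ) + 1)) • (G (eulerSeq G x₀ N l) - e) := by
      have : (((l + 1 : ℕ) : ℝ) - k) / (N + 1) = ((l : ℝ) - k) / (N + 1) + 1 / ((N : ℝ) + 1) := by
        push_cast; ring
      rw [this, eulerSeq, add_smul, smul_sub]
      abel
    rw [e1]
    refine (norm_add_le _ _).trans ?_
    rw [norm_smul, Real.norm_of_nonneg (by positivity)]
    have h3 : 1 / ((N : ℝ) + 1) * ‖G (eulerSeq G x₀ N l) - e‖ ≤ 1 / ((N : ℝ) + 1) * ε := by gcongr
    have h4 : ε * ((((l + 1 : ℕ) : ℝ) - k) / (N + 1))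
        = ε * (((l : ℝ) - k) / (N + 1)) + 1 / ((N : ℝ) + 1) * ε := by
      push_cast; ring
    linarith

lemma norm_eulerSeq_sub_eulerSeq_le {G : E → E} {M : ℝ} (hM : ∀ x, ‖G x‖ ≤ M) (x₀ : E)
    (N k l : ℕ) :
    ‖eulerSeq G x₀ N l - eulerSeq G x₀ N k‖ ≤ M * |(l : ℝ) / (N + 1) - (k : ℝ) / (N + 1)| := by
  wlog hkl : k ≤ l generalizing k l
  · rw [norm_sub_rev, abs_sub_comm]
    exact this l k (le_of_not_ge hkl)
  have h := norm_eulerSeq_sub_le (G := G) (x₀ := x₀) (N := N) (e := 0) (ε := M) hkl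
    (fun i _ _ => by simpa using hM _)
  have hN : (0 : ℝ) < N + 1 := by positivity
  have : (k : ℝ) ≤ l := by exact_mod_cast hkl
  rw [← sub_div, abs_of_nonneg (div_nonneg (by linarith) hN.le)]
  simpa using h

/-- **Peano's theorem** for a bounded continuous vector field, on the whole half-line. -/
theorem exists_solution_of_bounded [ProperSpace E] {G : E → E} (hG : Continuous G) {M : ℝ}
    (hM : ∀ x, ‖G x‖ ≤ M) (x₀ : E) :
    ∃ x : ℝ → E, x 0 = x₀ ∧ ∀ t, 0 ≤ t → HasDerivWithinAt x (G (x t)) (Ici 0) t := by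
  have hM0 : 0 ≤ M := (norm_nonneg _).trans (hM x₀)
  -- Limits along a free ultrafilter exist for all times simultaneously by compactness, replacing
  -- the extraction of a convergent subsequence.
  set U : Filter ℕ := (hyperfilter ℕ : Filter ℕ) with hU
  have hUatTop : U ≤ atTop := by
    rw [← Nat.cofinite_eq_atTop]; exact hyperfilter_le_cofinite
  let X : ℕ → ℝ → E := fun N t => eulerSeq G x₀ N ⌊t * ((N : ℝ) + 1)⌋₊
  have hfl : ∀ t : ℝ, 0 ≤ t →
      Tendsto (fun N : ℕ => (⌊t * ((N : ℝ) + 1)⌋₊ : ℝ) / ((N : ℝ) + 1)) U (𝓝 t) := by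
    intro t ht
    have h1 : Tendsto (fun N : ℕ => (N : ℝ) + 1) U atTop :=
      (tendsto_atTop_add_const_right _ _ tendsto_natCast_atTop_atTop).mono_left hUatTop
    exact (tendsto_nat_floor_mul_div_atTop ht).comp h1
  have hlim : ∀ t : ℝ, ∃ z, Tendsto (fun N => X N t) U (𝓝 z) := by
    intro t
    have hmem : ∀ N, X N t ∈ Metric.closedBall x₀ (M * |t|) := by
      intro N
      have h := norm_eulerSeq_sub_eulerSeq_le hM x₀ N 0 ⌊t * ((N : ℝ) + 1)⌋₊
      have hN : (0 : ℝ) < N + 1 := by positivity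
      rw [mem_closedBall_iff_norm]
      refine h.trans (mul_le_mul_of_nonneg_left ?_ hM0)
      rw [Nat.cast_zero, zero_div, sub_zero, abs_of_nonneg (by positivity), div_le_iff₀ hN]
      rcases le_total 0 t with ht | ht
      · rw [abs_of_nonneg ht]; exact Nat.floor_le (by positivity)
      · rw [Nat.floor_of_nonpos (mul_nonpos_of_nonpos_of_nonneg ht hN.le)]
        simp only [Nat.cast_zero]; positivity
    obtain ⟨z, -, hz⟩ := (isCompact_closedBall x₀ (M * |t|)).ultrafilter_le_nhds
      ((hyperfilter ℕ).map fun N => X N t) (by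
        simp only [Ultrafilter.coe_map, le_principal_iff, mem_map]
        exact Eventually.of_forall hmem)
    exact ⟨z, hz⟩
  choose x hx using hlim
  refine ⟨x, ?_, ?_⟩
  · refine tendsto_nhds_unique (hx 0) ?_
    have : (fun N => X N 0) = fun _ => x₀ := by
      funext N; simp [X, eulerSeq]
    rw [this]; exact tendsto_const_nhds
  intro t ht
  have key : ∀ ε > 0, ∃ δ > 0, ∀ a b : ℝ, 0 ≤ a → a ≤ b → |a - t| < δ → |b - t| < δ →
      ‖x b - x a - (b - a) • G (x t)‖ ≤ ε * (b - a) := by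
    intro ε hε
    obtain ⟨η, hη, hGη⟩ := Metric.continuousAt_iff.1 (hG.continuousAt (x := x t)) ε hε
    -- Euler nodes between `a` and `b` lie within twice this time from `t`, so they move at most `η
    -- / 2` from `X N t`; the other `η / 2` pays for `X N t → x t`.
    refine ⟨η / (4 * (M + 1)), by positivity, ?_⟩
    intro a b ha hab hat hbt
    have hb : 0 ≤ b := ha.trans hab
    have hconv : Tendsto (fun N : ℕ => ‖X N b - X N a -
        ((⌊b * ((N : ℝ) + 1)⌋₊ : ℝ) / ((N : ℝ) + 1) -
          (⌊a * ((N : ℝ) + 1)⌋₊ : ℝ) / ((N : ℝ) + 1)) • G (x t)‖) U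
        (𝓝 ‖x b - x a - (b - a) • G (x t)‖) :=
      (((hx b).sub (hx a)).sub (((hfl b hb).sub (hfl a ha)).smul_const _)).norm
    have hconv' : Tendsto (fun N : ℕ => ε * ((⌊b * ((N : ℝ) + 1)⌋₊ : ℝ) / ((N : ℝ) + 1) -
          (⌊a * ((N : ℝ) + 1)⌋₊ : ℝ) / ((N : ℝ) + 1))) U (𝓝 (ε * (b - a))) :=
      ((hfl b hb).sub (hfl a ha)).const_mul _
    refine le_of_tendsto_of_tendsto hconv hconv' ?_
    set d := η / (4 * (M + 1)) with hd
    have hd0 : 0 < d := by positivity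
    have hT := (hfl t ht).eventually (Metric.ball_mem_nhds _ hd0)
    have hX := (hx t).eventually (Metric.ball_mem_nhds _ (half_pos hη))
    filter_upwards [hX, (hfl a ha).eventually (Metric.ball_mem_nhds _ (sub_pos.2 hat)),
      (hfl b hb).eventually (Metric.ball_mem_nhds _ (sub_pos.2 hbt)), hT] with N hXN hAN hBN hTN
    have hN : (0 : ℝ) < N + 1 := by positivity
    rw [← sub_div]
    refine norm_eulerSeq_sub_le (Nat.floor_le_floor (by gcongr)) ?_
    intro i hi1 hi2
    have hdist : ‖eulerSeq G x₀ N i - x t‖ < η := by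
      have h1 := norm_eulerSeq_sub_eulerSeq_le hM x₀ N ⌊t * ((N : ℝ) + 1)⌋₊ i
      have i1 : (⌊a * ((N : ℝ) + 1)⌋₊ : ℝ) / (N + 1) ≤ (i : ℝ) / (N + 1) := by gcongr
      have i2 : (i : ℝ) / (N + 1) ≤ (⌊b * ((N : ℝ) + 1)⌋₊ : ℝ) / (N + 1) := by gcongr
      rw [Real.dist_eq] at hAN hBN hTN
      rw [dist_eq_norm] at hXN
      have h2 : |(i : ℝ) / (N + 1) - (⌊t * ((N : ℝ) + 1)⌋₊ : ℝ) / (N + 1)| ≤ 2 * d := by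
        have := abs_lt.1 hAN
        have := abs_lt.1 hBN
        have := abs_lt.1 hTN
        have := le_abs_self (b - t)
        have := neg_abs_le (a - t)
        rw [abs_le]; constructor <;> linarith
      have h3 : M * |(i : ℝ) / (N + 1) - (⌊t * ((N : ℝ) + 1)⌋₊ : ℝ) / (N + 1)| ≤ η / 2 := by
        calc _ ≤ (M + 1) * (2 * d) := by gcongr; linarith
          _ = η / 2 := by rw [hd]; field_simp; ring
      calc _ = ‖(eulerSeq G x₀ N i - X N t) + (X N t - x t)‖ := by rw [sub_add_sub_cancel]
        _ ≤ ‖eulerSeq G x₀ N i - X N t‖ + ‖X N t - x t‖ := norm_add_le _ _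
        _ < η := by linarith [h1.trans h3]
    have := hGη (by rwa [dist_eq_norm])
    rw [dist_eq_norm] at this
    exact this.le
  rw [hasDerivWithinAt_iff_isLittleO, Asymptotics.isLittleO_iff]
  intro ε hε
  obtain ⟨δ, hδ, h⟩ := key ε hε
  filter_upwards [self_mem_nhdsWithin, nhdsWithin_le_nhds (Metric.ball_mem_nhds t hδ)] with s hs hst
  rw [Metric.mem_ball, Real.dist_eq] at hst
  rcases le_total t s with hts | hts
  · have := h t s ht hts (by simpa using hδ) hst
    rwa [Real.norm_of_nonneg (sub_nonneg.2 hts)]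
  · have := h s t hs hts hst (by simpa using hδ)
    rw [norm_sub_rev, Real.norm_of_nonpos (sub_nonpos.2 hts)]
    have e1 : x t - x s - (t - s) • G (x t) = (s - t) • G (x t) - (x s - x t) := by
      rw [← neg_sub s t, neg_smul]; abel
    rw [e1] at this
    linarith

end Peano

/-! ### Right derivatives along a monotone vector field -/

section Dini

variable {E : Type*} [NormedAddCommGroup E] [InnerProductSpace ℝ E]

/-- Along a curve moving with velocity `-N`, where `N` is monotone and locally Lipschitz, the
squared norm of `N` has nonpositive upper right derivative. -/
lemma eventually_norm_sq_le_of_monotone {N : E → E} (hmono : ∀ a b, 0 ≤ inner ℝ (a - b) (N a - N b))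
    (hlip : LocallyLipschitz N) {x : ℝ → E} {t : ℝ}
    (hx : HasDerivWithinAt x (-N (x t)) (Ioi t) t) {ε : ℝ} (hε : 0 < ε) :
    ∀ᶠ s in 𝓝[>] t, ‖N (x s)‖ ^ 2 ≤ ‖N (x t)‖ ^ 2 + ε * (s - t) := by
  obtain ⟨K, S, hS, hK⟩ := hlip (x t)
  have hK0 : (0 : ℝ) ≤ K := K.2
  set v := -N (x t) with hv
  set C : ℝ := ‖v‖ + 1 with hC
  have hC0 : 0 < C := by positivity
  have hcont : Tendsto x (𝓝[>] t) (𝓝 (x t)) := hx.continuousWithinAt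
  -- The `1` gives `‖d‖ ≤ (‖v‖ + 1) τ`; the other entry makes the cross term at most `ε / 2 * τ`,
  -- leaving `ε / 2 * τ` for `‖Δ‖ ^ 2`, which is quadratic in `τ`.
  set η : ℝ := min 1 (ε / (4 * (K * C + 1))) with hη
  have hη0 : 0 < η := by positivity
  have hlo := (Asymptotics.isLittleO_iff.1 (hasDerivWithinAt_iff_isLittleO.1 hx)) hη0
  have hsmall : ∀ᶠ s in 𝓝[>] t, s - t < ε / (2 * ((K * C) ^ 2 + 1)) := by
    have : Tendsto (fun s : ℝ => s - t) (𝓝[>] t) (𝓝 (t - t)) :=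
      ((continuous_id.sub continuous_const).tendsto t).mono_left nhdsWithin_le_nhds
    rw [sub_self] at this
    exact this.eventually (gt_mem_nhds (by positivity))
  filter_upwards [self_mem_nhdsWithin, hcont.eventually hS, hlo, hsmall] with s hs hsS hls hss
  have hst : 0 < s - t := sub_pos.2 hs
  set τ := s - t with hτ
  rw [Real.norm_of_nonneg hst.le] at hls
  set d := x s - x t with hd
  set Δ := N (x s) - N (x t) with hΔ
  have hdle : ‖d‖ ≤ C * τ := by
    have h1 : ‖d‖ ≤ ‖d - τ • v‖ + ‖τ • v‖ := by
      simpa using norm_add_le (d - τ • v) (τ • v)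
    rw [norm_smul, Real.norm_of_nonneg hst.le] at h1
    have : η * τ ≤ 1 * τ := by gcongr; exact min_le_left _ _
    rw [hC]; linarith
  have hΔle : ‖Δ‖ ≤ K * C * τ := by
    have h1 := hK.dist_le_mul _ hsS _ (mem_of_mem_nhds hS)
    rw [dist_eq_norm, dist_eq_norm] at h1
    calc ‖Δ‖ ≤ K * ‖d‖ := h1
      _ ≤ K * (C * τ) := by gcongr
      _ = _ := by ring
  -- Monotonicity concerns the true displacement `d`; replacing it by `τ • v` costs only `o(τ) *
  -- O(τ)`, so `⟪v, Δ⟫` is almost nonnegative.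
  have hm : 0 ≤ inner ℝ d Δ := hmono _ _
  have h1 : inner ℝ (d - τ • v) Δ ≤ η * τ * (K * C * τ) :=
    (real_inner_le_norm _ _).trans (by gcongr)
  have h2 : inner ℝ (d - τ • v) Δ = inner ℝ d Δ - τ * inner ℝ v Δ := by
    rw [inner_sub_left, real_inner_smul_left]
  have h3 : -(η * (K * C) * τ) ≤ inner ℝ v Δ := by
    have : τ * (-(η * (K * C) * τ)) ≤ τ * inner ℝ v Δ := by nlinarith
    exact le_of_mul_le_mul_left this hst
  have h4 : ‖N (x s)‖ ^ 2 = ‖N (x t)‖ ^ 2 - 2 * inner ℝ v Δ + ‖Δ‖ ^ 2 := by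
    have : N (x s) = Δ - v := by rw [hΔ, hv]; abel
    rw [this, norm_sub_sq_real, real_inner_comm, hv, norm_neg]; ring
  have h5 : ‖Δ‖ ^ 2 ≤ (K * C * τ) ^ 2 := by gcongr
  have h6 : η * (K * C) ≤ ε / 4 := by
    have : η * (K * C + 1) ≤ ε / (4 * (K * C + 1)) * (K * C + 1) := by
      gcongr; exact min_le_right _ _
    have e : ε / (4 * (K * C + 1)) * (K * C + 1) = ε / 4 := by field_simp
    rw [e] at this
    nlinarith
  have h7 : (K * C) ^ 2 * τ ≤ ε / 2 := by
    have h := (lt_div_iff₀ (by positivity)).1 hss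
    nlinarith
  have h8 : (K * C * τ) ^ 2 ≤ ε / 2 * τ := by
    calc _ = ((K * C) ^ 2 * τ) * τ := by ring
      _ ≤ _ := by gcongr
  have h9 : η * (K * C) * τ ≤ ε / 4 * τ := by gcongr
  linarith

end Dini

/-! ### Multipliers -/

section Multipliers

variable {E : Type*} [NormedAddCommGroup E] [InnerProductSpace ℝ E]
  {ι κ : Type*} [Fintype ι]

/-- The cone generated by the vectors `a i`, `i ∈ I`, and the lines through the `r j`. -/
def multiplierCone (a : ι → E) (r : κ → E) (I : Set ι) : Set E :=
  {z | ∃ u : ι → ℝ, (∀ i, 0 ≤ u i) ∧ (∀ i ∉ I, u i = 0) ∧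
    z - ∑ i, u i • a i ∈ Submodule.span ℝ (range r)}

lemma convex_multiplierCone (a : ι → E) (r : κ → E) (I : Set ι) :
    Convex ℝ (multiplierCone a r I) := by
  rintro z ⟨u, hu, huI, hz⟩ z' ⟨u', hu', huI', hz'⟩ s s' hs hs' -
  refine ⟨fun i => s * u i + s' * u' i, fun i => ?_, fun i hi => ?_, ?_⟩
  · have := hu i; have := hu' i; positivity
  · simp [huI i hi, huI' i hi]
  · have e : s • z + s' • z' - ∑ i, (s * u i + s' * u' i) • a i
        = s • (z - ∑ i, u i • a i) + s' • (z' - ∑ i, u' i • a i) := by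
      simp only [add_smul, mul_smul, Finset.sum_add_distrib, ← Finset.smul_sum, smul_sub]
      abel
    rw [e]
    exact Submodule.add_mem _ (Submodule.smul_mem _ _ hz) (Submodule.smul_mem _ _ hz')

/-- Pairing with `d` kills the span of the `r j` and gives every generator the same strict sign, so
no cancellation is possible: the coefficients of points in a bounded set are bounded, and a limit of
coefficients represents the limit point. -/
lemma isClosed_multiplierCone [FiniteDimensional ℝ E] {a : ι → E} {r : κ → E} {I : Set ι} {d : E}
    (hd : ∀ i ∈ I, inner ℝ (a i) d < 0) (hr : ∀ j, inner ℝ (r j) d = 0) :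
    IsClosed (multiplierCone a r I) := by
  classical
  have hspan : ∀ w ∈ Submodule.span ℝ (range r), inner ℝ w d = 0 := by
    intro w hw
    induction hw using Submodule.span_induction with
    | mem w hw => obtain ⟨j, rfl⟩ := hw; exact hr j
    | zero => simp
    | add w w' _ _ h h' => rw [inner_add_left, h, h', add_zero]
    | smul s w _ h => rw [real_inner_smul_left, h, mul_zero]
  rw [isClosed_iff_ultrafilter]
  intro z l hl hS
  -- A choice of coefficients; the default `0` off the cone is harmless, because the ultrafilter
  -- contains the cone.
  let f : E → ι → ℝ := fun y =>
    if h : y ∈ multiplierCone a r I then h.choose else 0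
  have hf : ∀ y ∈ multiplierCone a r I, (∀ i, 0 ≤ f y i) ∧ (∀ i ∉ I, f y i = 0) ∧
      y - ∑ i, f y i • a i ∈ Submodule.span ℝ (range r) := by
    intro y hy
    have := hy.choose_spec
    simpa only [f, dif_pos hy] using this
  have hbound : ∀ y ∈ multiplierCone a r I, ∀ i ∈ I,
      f y i * (-inner ℝ (a i) d) ≤ -inner ℝ y d := by
    intro y hy i hi
    obtain ⟨h0, hI, hs⟩ := hf y hy
    have h1 := hspan _ hs
    rw [inner_sub_left, sum_inner] at h1
    have h2 : inner ℝ (f y i • a i) d ≥ ∑ i, inner ℝ (f y i • a i) d := by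
      rw [ge_iff_le, ← Finset.add_sum_erase _ _ (Finset.mem_univ i)]
      have : ∑ x ∈ Finset.univ.erase i, inner ℝ (f y x • a x) d ≤ 0 := by
        refine Finset.sum_nonpos fun j _ => ?_
        rw [real_inner_smul_left]
        by_cases hj : j ∈ I
        · exact mul_nonpos_of_nonneg_of_nonpos (h0 j) (hd j hj).le
        · rw [hI j hj, zero_mul]
      linarith
    rw [real_inner_smul_left] at h2
    linarith
  set B : ι → ℝ := fun i => (‖z‖ + 1) * ‖d‖ / |inner ℝ (a i) d| with hB
  have hmem : ∀ᶠ y in (l : Filter E), f y ∈ Icc 0 B := by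
    have hball : ∀ᶠ y in (l : Filter E), ‖y‖ < ‖z‖ + 1 :=
      hl (continuous_norm.continuousAt.eventually (gt_mem_nhds (by linarith)))
    filter_upwards [hball, hS] with y hy hyS
    refine ⟨fun i => (hf y hyS).1 i, fun i => ?_⟩
    by_cases hi : i ∈ I
    · have h1 := hbound y hyS i hi
      have h2 := hd i hi
      rw [hB]
      simp only
      rw [abs_of_neg h2, le_div_iff₀ (by linarith)]
      have h3 : -inner ℝ y d ≤ ‖y‖ * ‖d‖ :=
        (neg_le_abs _).trans (abs_real_inner_le_norm _ _)
      have h4 : ‖y‖ * ‖d‖ ≤ (‖z‖ + 1) * ‖d‖ := by gcongr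
      linarith
    · rw [(hf y hyS).2.1 i hi, hB]; positivity
  obtain ⟨u, -, hu⟩ := (isCompact_Icc (a := (0 : ι → ℝ)) (b := B)).ultrafilter_le_nhds (l.map f)
    (le_principal_iff.2 hmem)
  have hu' : Tendsto f l (𝓝 u) := hu
  have hui : ∀ i, Tendsto (fun y => f y i) l (𝓝 (u i)) := fun i => (tendsto_pi_nhds.1 hu') i
  refine ⟨u, fun i => ?_, fun i hi => ?_, ?_⟩
  · refine ge_of_tendsto (hui i) ?_
    filter_upwards [hS] with y hy using (hf y hy).1 i
  · refine tendsto_nhds_unique (hui i) (tendsto_const_nhds.congr' ?_)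
    filter_upwards [hS] with y hy using ((hf y hy).2.1 i hi).symm
  · have hlim : Tendsto (fun y => y - ∑ i, f y i • a i) l (𝓝 (z - ∑ i, u i • a i)) :=
      Tendsto.sub hl (tendsto_finsetSum _ fun i _ => (hui i).smul_const _)
    refine (Submodule.closed_of_finiteDimensional (Submodule.span ℝ (range r))).mem_of_tendsto
      hlim ?_
    filter_upwards [hS] with y hy using (hf y hy).2.2

/-- Farkas' lemma for a family of vectors satisfying a Mangasarian-Fromovitz condition. -/
theorem exists_multipliers [FiniteDimensional ℝ E] [Fintype κ] {a : ι → E} {r : κ → E} {I : Set ι} {d z : E}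
    (hd : ∀ i ∈ I, inner ℝ (a i) d < 0) (hr : ∀ j, inner ℝ (r j) d = 0)
    (hz : ∀ ζ, (∀ i ∈ I, inner ℝ (a i) ζ ≤ 0) → (∀ j, inner ℝ (r j) ζ = 0) → inner ℝ z ζ ≤ 0) :
    ∃ (u : ι → ℝ) (v : κ → ℝ), (∀ i, 0 ≤ u i) ∧ (∀ i ∉ I, u i = 0) ∧
      z = ∑ i, u i • a i + ∑ j, v j • r j := by
  suffices hmem : z ∈ multiplierCone a r I by
    obtain ⟨u, hu, huI, hs⟩ := hmem
    obtain ⟨v, hv⟩ := (Submodule.mem_span_range_iff_exists_fun ℝ).1 hs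
    exact ⟨u, v, hu, huI, by rw [hv]; abel⟩
  have hne : (multiplierCone a r I).Nonempty := ⟨0, 0, by simp, by simp, by simp⟩
  -- Let `y` be the projection of `z` onto the cone. The residual `z - y` pairs nonpositively with
  -- all generators, so `hz` applies to it; comparison with the apex `0` then forces `‖z - y‖² ≤ 0`.
  obtain ⟨y, hy, hmin⟩ := exists_norm_eq_iInf_of_complete_convex hne
    (isClosed_multiplierCone hd hr).isComplete (convex_multiplierCone a r I) z
  rw [norm_eq_iInf_iff_real_inner_le_zero (convex_multiplierCone a r I) hy] at hmin
  have hadd : ∀ w, (∃ u : ι → ℝ, (∀ i, 0 ≤ u i) ∧ (∀ i ∉ I, u i = 0) ∧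
      w - ∑ i, u i • a i ∈ Submodule.span ℝ (range r)) → inner ℝ (z - y) w ≤ 0 := by
    rintro w ⟨u, hu, huI, hw⟩
    obtain ⟨u', hu', huI', hy'⟩ := hy
    have := hmin (y + w) ⟨fun i => u' i + u i, fun i => add_nonneg (hu' i) (hu i),
      fun i hi => by simp [huI i hi, huI' i hi], by
        have e : y + w - ∑ i, (u' i + u i) • a i
            = (y - ∑ i, u' i • a i) + (w - ∑ i, u i • a i) := by
          simp only [add_smul, Finset.sum_add_distrib]; abel
        rw [e]; exact Submodule.add_mem _ hy' hw⟩
    rwa [add_sub_cancel_left] at this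
  have hspan : ∀ w ∈ Submodule.span ℝ (range r), inner ℝ (z - y) w ≤ 0 := fun w hw =>
    hadd w ⟨0, fun _ => le_rfl, fun _ _ => rfl, by simpa using hw⟩
  have h1 : inner ℝ z (z - y) ≤ 0 := by
    classical
    refine hz _ (fun i hi => ?_) (fun j => ?_)
    · rw [real_inner_comm]
      refine hadd _ ⟨Pi.single i 1, fun j => ?_, fun j hj => ?_, ?_⟩
      · by_cases h : j = i
        · subst h; simp
        · simp [Pi.single_eq_of_ne h]
      · exact Pi.single_eq_of_ne (by rintro rfl; exact hj hi) _
      · simp [Pi.single_apply, ite_smul]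
    · have ha := hspan _ (Submodule.subset_span (mem_range_self j))
      have hb := hspan _ (Submodule.neg_mem _ (Submodule.subset_span (mem_range_self j)))
      rw [inner_neg_right] at hb
      rw [real_inner_comm]; linarith
  have h2 : 0 ≤ inner ℝ (z - y) y := by
    have := hmin 0 ⟨0, fun _ => le_rfl, fun _ _ => rfl, by simp⟩
    rw [zero_sub, inner_neg_right] at this
    linarith
  have h3 : inner ℝ (z - y) (z - y) ≤ 0 := by
    rw [inner_sub_right, real_inner_comm]; linarith
  have h4 : z - y = 0 := by
    rw [real_inner_self_eq_norm_sq] at h3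
    exact norm_eq_zero.1 (pow_eq_zero_iff two_ne_zero |>.1 (le_antisymm h3 (sq_nonneg _)))
  rwa [sub_eq_zero.1 h4]

end Multipliers

variable {n m k : ℕ}

/-! ### Convex functions and their gradients -/

section Gradient

variable {E : Type*} [NormedAddCommGroup E] [InnerProductSpace ℝ E] [CompleteSpace E]

lemma hasDerivWithinAt_comp_gradient {f : E → ℝ} (hf : Differentiable ℝ f) {x : ℝ → E} {v : E}
    {S : Set ℝ} {t : ℝ} (hx : HasDerivWithinAt x v S t) :
    HasDerivWithinAt (fun s => f (x s)) (inner ℝ (gradient f (x t)) v) S t := by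
  rw [inner_gradient_left]
  exact (hf (x t)).hasFDerivAt.comp_hasDerivWithinAt t hx

lemma hasDerivAt_line (f : E → ℝ) (hf : Differentiable ℝ f) (x v : E) :
    HasDerivAt (fun s : ℝ => f (x + s • v)) (inner ℝ (gradient f x) v) 0 := by
  have h : HasDerivWithinAt (fun s : ℝ => x + s • v) v univ 0 := by
    have := ((hasDerivAt_id (0 : ℝ)).smul_const v).const_add x
    simpa using this.hasDerivWithinAt (s := univ)
  have := hasDerivWithinAt_comp_gradient hf h
  simpa using this

lemma add_inner_gradient_le {f : E → ℝ} (hf : Differentiable ℝ f) (hc : ConvexOn ℝ univ f)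
    (x y : E) : f x + inner ℝ (gradient f x) (y - x) ≤ f y := by
  have hconv : ConvexOn ℝ univ (fun s : ℝ => f (x + s • (y - x))) := by
    have := hc.comp_affineMap (AffineMap.lineMap x y : ℝ →ᵃ[ℝ] E)
    refine (this.congr fun s _ => ?_)
    simp [AffineMap.lineMap_apply_module', add_comm]
  have h := hconv.le_slope_of_hasDerivAt (mem_univ 0) (mem_univ 1) zero_lt_one
    (hasDerivAt_line f hf x (y - x))
  simp only [slope_def_field, one_smul, zero_smul, add_zero, add_sub_cancel, sub_zero,
    div_one] at h
  linarith

lemma inner_gradient_sub_nonneg {f : E → ℝ} (hf : Differentiable ℝ f) (hc : ConvexOn ℝ univ f)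
    (x y : E) : 0 ≤ inner ℝ (x - y) (gradient f x - gradient f y) := by
  have h1 := add_inner_gradient_le hf hc x y
  have h2 := add_inner_gradient_le hf hc y x
  have h3 : inner ℝ (gradient f x) (y - x) = -inner ℝ (x - y) (gradient f x) := by
    rw [← neg_sub x y, inner_neg_right, real_inner_comm]
  rw [inner_sub_right, real_inner_comm (gradient f y)]
  linarith

/-- A function that is nonpositive at `x`, with negative slope in the direction `v` if it vanishes
there, is negative a little further in the direction `v`. -/
lemma eventually_line_neg {f : E → ℝ} (hf : Differentiable ℝ f) {x v : E} (h0 : f x ≤ 0)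
    (hv : f x = 0 → inner ℝ (gradient f x) v < 0) :
    ∀ᶠ s in 𝓝[>] (0 : ℝ), f (x + s • v) < 0 := by
  rcases h0.lt_or_eq with h | h
  · have hc : ContinuousAt (fun s : ℝ => f (x + s • v)) 0 := (hasDerivAt_line f hf x v).continuousAt
    refine nhdsWithin_le_nhds (hc.eventually (gt_mem_nhds ?_))
    simpa using h
  · have hd := (hasDerivAt_line f hf x v).hasDerivWithinAt (s := Ioi 0)
    have := (hasDerivWithinAt_iff_tendsto_slope' (by simp)).1 hd
    filter_upwards [this.eventually (gt_mem_nhds (hv h)), self_mem_nhdsWithin] with s hs hs0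
    rw [slope_def_field] at hs
    simp only [zero_smul, add_zero, h, sub_zero] at hs
    exact ((div_neg_iff).1 hs).resolve_left (fun h' => absurd h'.2 (not_lt.2 (le_of_lt hs0))) |>.1

end Gradient

/-! ### The feasible velocities and the projected field -/

/-- The velocities `ζ` with `∇gᵢ(x)ᵀ ζ ≤ -α gᵢ(x)` and `∇hⱼ(x)ᵀ ζ = -α hⱼ(x)`. -/
def feasibleVelocities (g : Fin m → Vec n → ℝ) (h : Fin k → Vec n → ℝ) (α : ℝ) (x : Vec n) :
    Set (Vec n) :=
  {ζ | (∀ i, inner ℝ (gradient (g i) x) ζ ≤ -α * g i x) ∧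
    ∀ j, inner ℝ (gradient (h j) x) ζ = -α * h j x}

/-- The hypotheses under which the flow is studied: convex inequality constraints, affine equality
constraints with constant gradients `r j`, and a Slater point `z`. -/
structure IsSlaterProblem (F : Vec n → Vec n) (g : Fin m → Vec n → ℝ) (h : Fin k → Vec n → ℝ)
    (r : Fin k → Vec n) (α : ℝ) (z : Vec n) : Prop where
  alpha_pos : 0 < α
  lip_F : LocallyLipschitz F
  diff_g : ∀ i, Differentiable ℝ (g i)
  lip_grad : ∀ i, LocallyLipschitz (gradient (g i))
  convex_g : ∀ i, ConvexOn ℝ univ (g i)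
  grad_h : ∀ j x, gradient (h j) x = r j
  h_sub : ∀ j x y, h j y - h j x = inner ℝ (r j) (y - x)
  g_neg : ∀ i, g i z < 0
  h_zero : ∀ j, h j z = 0

lemma convex_feasibleVelocities (g : Fin m → Vec n → ℝ) (h : Fin k → Vec n → ℝ) (α : ℝ)
    (x : Vec n) : Convex ℝ (feasibleVelocities g h α x) := by
  rintro ζ ⟨h1, h2⟩ ζ' ⟨h1', h2'⟩ s s' hs hs' hss
  refine ⟨fun i => ?_, fun j => ?_⟩
  · rw [inner_add_right, real_inner_smul_right, real_inner_smul_right]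
    calc _ ≤ s * (-α * g i x) + s' * (-α * g i x) :=
          add_le_add (mul_le_mul_of_nonneg_left (h1 i) hs) (mul_le_mul_of_nonneg_left (h1' i) hs')
      _ = _ := by rw [← add_mul, hss, one_mul]
  · rw [inner_add_right, real_inner_smul_right, real_inner_smul_right, h2 j, h2' j, ← add_mul, hss,
      one_mul]

lemma isClosed_feasibleVelocities (g : Fin m → Vec n → ℝ) (h : Fin k → Vec n → ℝ) (α : ℝ)
    (x : Vec n) : IsClosed (feasibleVelocities g h α x) := by
  have e : feasibleVelocities g h α x =
      (⋂ i, {ζ | inner ℝ (gradient (g i) x) ζ ≤ -α * g i x}) ∩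
        ⋂ j, {ζ | inner ℝ (gradient (h j) x) ζ = -α * h j x} := by
    ext ζ; simp [feasibleVelocities]
  rw [e]
  refine (isClosed_iInter fun i => ?_).inter (isClosed_iInter fun j => ?_)
  · exact isClosed_le (by fun_prop) continuous_const
  · exact isClosed_eq (by fun_prop) continuous_const

/-- `ξ` is the feasible velocity closest to `-F x`. -/
def IsClosestVelocity (F : Vec n → Vec n) (g : Fin m → Vec n → ℝ) (h : Fin k → Vec n → ℝ) (α : ℝ)
    (x ξ : Vec n) : Prop :=
  ξ ∈ feasibleVelocities g h α x ∧
    ∀ ζ ∈ feasibleVelocities g h α x, 0 ≤ inner ℝ (F x + ξ) (ζ - ξ)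

/-- The feasible velocity closest to `-F x`, as a vector field. -/
def flowField (F : Vec n → Vec n) (g : Fin m → Vec n → ℝ) (h : Fin k → Vec n → ℝ) (α : ℝ)
    (x : Vec n) : Vec n :=
  Classical.epsilon (IsClosestVelocity F g h α x)

lemma IsClosestVelocity.norm_sq_add_le {F : Vec n → Vec n} {g : Fin m → Vec n → ℝ}
    {h : Fin k → Vec n → ℝ} {α : ℝ} {x ξ ζ : Vec n} (hξ : IsClosestVelocity F g h α x ξ)
    (hζ : ζ ∈ feasibleVelocities g h α x) :
    ‖F x + ξ‖ ^ 2 + ‖ζ - ξ‖ ^ 2 ≤ ‖F x + ζ‖ ^ 2 := by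
  have h1 := hξ.2 ζ hζ
  have h2 : F x + ζ = (F x + ξ) + (ζ - ξ) := by abel
  rw [h2, norm_add_sq_real (F x + ξ)]
  linarith

lemma IsClosestVelocity.of_norm_le {F : Vec n → Vec n} {g : Fin m → Vec n → ℝ}
    {h : Fin k → Vec n → ℝ} {α : ℝ} {x ξ ξ' : Vec n} (hξ : IsClosestVelocity F g h α x ξ)
    (hξ' : ξ' ∈ feasibleVelocities g h α x) (hle : ‖F x + ξ'‖ ≤ ‖F x + ξ‖) : ξ' = ξ := by
  have h1 := hξ.norm_sq_add_le hξ'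
  have h2 : ‖F x + ξ'‖ ^ 2 ≤ ‖F x + ξ‖ ^ 2 := by gcongr
  have h3 : ‖ξ' - ξ‖ ^ 2 ≤ 0 := by linarith
  exact sub_eq_zero.1 (norm_eq_zero.1
    (pow_eq_zero_iff two_ne_zero |>.1 (le_antisymm h3 (sq_nonneg _))))

lemma controlField_eq_iff {F : Vec n → Vec n} {g : Fin m → Vec n → ℝ} {h : Fin k → Vec n → ℝ}
    {x ξ : Vec n} {u : Fin m → ℝ} {v : Fin k → ℝ} :
    ξ = controlField F g h x u v ↔ -(F x + ξ) = inputTerm g h x u v := by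
  rw [controlField]
  constructor
  · rintro rfl; abel
  · intro h; rw [← h]; abel

namespace IsSlaterProblem

variable {F : Vec n → Vec n} {g : Fin m → Vec n → ℝ} {h : Fin k → Vec n → ℝ}
  {r : Fin k → Vec n} {α : ℝ} {z : Vec n}

lemma differentiable_h (P : IsSlaterProblem F g h r α z) (j : Fin k) : Differentiable ℝ (h j) := by
  have : h j = fun y => h j 0 + inner ℝ (r j) (y - 0) := by
    funext y; rw [← P.h_sub]; ring
  rw [this]
  exact ((differentiable_const _).inner ℝ (differentiable_id.sub_const 0)).const_add _

/-- The tangent inequality for convex `g i` makes the straight velocity towards any feasible point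
admissible, even when `x` is infeasible. -/
lemma smul_sub_mem (P : IsSlaterProblem F g h r α z) {y : Vec n} (hy : y ∈ constraintSet g h)
    (x : Vec n) : α • (y - x) ∈ feasibleVelocities g h α x := by
  refine ⟨fun i => ?_, fun j => ?_⟩
  · rw [real_inner_smul_right]
    have h1 := add_inner_gradient_le (P.diff_g i) (P.convex_g i) x y
    have h2 := hy.1 i
    have : inner ℝ (gradient (g i) x) (y - x) ≤ -g i x := by linarith
    calc _ ≤ α * -g i x := mul_le_mul_of_nonneg_left this P.alpha_pos.le
      _ = _ := by ring
  · rw [real_inner_smul_right, P.grad_h, ← P.h_sub, hy.2 j]; ring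

lemma slater_mem (P : IsSlaterProblem F g h r α z) : z ∈ constraintSet g h :=
  ⟨fun i => (P.g_neg i).le, P.h_zero⟩

lemma inner_slater_lt (P : IsSlaterProblem F g h r α z) (x : Vec n) (i : Fin m) :
    inner ℝ (gradient (g i) x) (α • (z - x)) < -α * g i x := by
  rw [real_inner_smul_right]
  have h1 := add_inner_gradient_le (P.diff_g i) (P.convex_g i) x z
  have h2 := P.g_neg i
  have : inner ℝ (gradient (g i) x) (z - x) < -g i x := by linarith
  calc _ < α * -g i x := mul_lt_mul_of_pos_left this P.alpha_pos
    _ = _ := by ring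

lemma isClosestVelocity_flowField (P : IsSlaterProblem F g h r α z) (x : Vec n) :
    IsClosestVelocity F g h α x (flowField F g h α x) := by
  refine Classical.epsilon_spec (p := IsClosestVelocity F g h α x) ?_
  obtain ⟨ξ, hξ, hmin⟩ := exists_norm_eq_iInf_of_complete_convex ⟨_, P.smul_sub_mem P.slater_mem x⟩
    (isClosed_feasibleVelocities g h α x).isComplete (convex_feasibleVelocities g h α x) (-F x)
  rw [norm_eq_iInf_iff_real_inner_le_zero (convex_feasibleVelocities g h α x) hξ] at hmin
  refine ⟨ξ, hξ, fun ζ hζ => ?_⟩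
  have := hmin ζ hζ
  have e : -F x - ξ = -(F x + ξ) := by abel
  rw [e, inner_neg_left] at this
  linarith

lemma norm_flowField_le (P : IsSlaterProblem F g h r α z) {x ζ : Vec n}
    (hζ : ζ ∈ feasibleVelocities g h α x) :
    ‖F x + flowField F g h α x‖ ≤ ‖F x + ζ‖ := by
  have := (P.isClosestVelocity_flowField x).norm_sq_add_le hζ
  exact le_of_sq_le_sq (by linarith [sq_nonneg ‖ζ - flowField F g h α x‖]) (norm_nonneg _)

/-- Any limit `ξ` of projections at nearby points is feasible at `x`. It is also optimal, because
competitors at `x`, once pushed towards the Slater velocity, can be transported to competitors at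
nearby points. -/
lemma continuous_flowField (P : IsSlaterProblem F g h r α z) :
    Continuous (flowField F g h α) := by
  have hFc : Continuous F := P.lip_F.continuous
  have hgc : ∀ i, Continuous (g i) := fun i => (P.diff_g i).continuous
  have hgg : ∀ i, Continuous (gradient (g i)) := fun i => (P.lip_grad i).continuous
  have hhc : ∀ j, Continuous (h j) := fun j => (P.differentiable_h j).continuous
  rw [continuous_iff_continuousAt]
  intro x
  rw [ContinuousAt, tendsto_iff_ultrafilter]
  intro l hl
  have hlim : ∀ {β : Type} [TopologicalSpace β] {f : Vec n → β}, Continuous f →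
      Tendsto f l (𝓝 (f x)) := fun hf => (hf.tendsto x).mono_left hl
  set G := flowField F g h α with hG
  set R : ℝ := ‖F x + α • (z - x)‖ + ‖F x‖ + 1 with hR
  have hbound : ∀ᶠ y in (l : Filter (Vec n)), G y ∈ Metric.closedBall 0 R := by
    have hc : Continuous fun y => ‖F y + α • (z - y)‖ + ‖F y‖ := by fun_prop
    filter_upwards [(hlim hc).eventually (gt_mem_nhds (lt_add_one _))] with y hy
    have h1 := P.norm_flowField_le (P.smul_sub_mem P.slater_mem y)
    have h2 : ‖G y‖ ≤ ‖F y + G y‖ + ‖F y‖ := by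
      calc ‖G y‖ = ‖(F y + G y) - F y‖ := by rw [add_sub_cancel_left]
        _ ≤ _ := norm_sub_le _ _
    rw [mem_closedBall_zero_iff]
    linarith
  obtain ⟨ξ, -, hξ⟩ := (isCompact_closedBall (0 : Vec n) R).ultrafilter_le_nhds (l.map G)
    (le_principal_iff.2 hbound)
  have hξ' : Tendsto G l (𝓝 ξ) := hξ
  have hmem : ξ ∈ feasibleVelocities g h α x := by
    refine ⟨fun i => ?_, fun j => ?_⟩
    · exact le_of_tendsto_of_tendsto' ((hlim (hgg i)).inner hξ') ((hlim (hgc i)).const_mul (-α))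
        fun y => (P.isClosestVelocity_flowField y).1.1 i
    · refine tendsto_nhds_unique (f := fun y => inner ℝ (gradient (h j) y) (G y)) (l := (l : Filter _))
        ?_ (((hlim (hhc j)).const_mul (-α)).congr
        fun y => ((P.isClosestVelocity_flowField y).1.2 j).symm)
      simp only [P.grad_h]
      exact tendsto_const_nhds.inner hξ'
  have hle : ∀ ζ ∈ feasibleVelocities g h α x, ∀ s ∈ Ioo (0 : ℝ) 1,
      ‖F x + ξ‖ ≤ ‖F x + ((1 - s) • ζ + s • (α • (z - x)))‖ := by
    intro ζ hζ s hs
    -- The shift `α • (x - y)` makes the affine equality constraints hold exactly at `y`; the Slater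
    -- fraction `s` makes the inequalities strict at `x`, hence valid nearby.
    let w : Vec n → Vec n := fun y => (1 - s) • (ζ + α • (x - y)) + s • (α • (z - y))
    have hw : Continuous w := by fun_prop
    have hwx : w x = (1 - s) • ζ + s • (α • (z - x)) := by simp [w]
    have hineq : ∀ i, ∀ᶠ y in (l : Filter (Vec n)),
        inner ℝ (gradient (g i) y) (w y) < -α * g i y := by
      intro i
      have hc : Continuous fun y => inner ℝ (gradient (g i) y) (w y) + α * g i y := by fun_prop
      have hneg : inner ℝ (gradient (g i) x) (w x) + α * g i x < 0 := by
        rw [hwx, inner_add_right, real_inner_smul_right, real_inner_smul_right]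
        have h1 := mul_le_mul_of_nonneg_left (hζ.1 i) (sub_nonneg.2 hs.2.le)
        have h2 := mul_lt_mul_of_pos_left (P.inner_slater_lt x i) hs.1
        linarith
      filter_upwards [(hlim hc).eventually (gt_mem_nhds hneg)] with y hy
      linarith
    have hev : ∀ᶠ y in (l : Filter (Vec n)), ‖F y + G y‖ ≤ ‖F y + w y‖ := by
      filter_upwards [eventually_all.2 hineq] with y hy
      refine P.norm_flowField_le ⟨fun i => (hy i).le, fun j => ?_⟩
      have h1 := hζ.2 j
      have h2 := P.h_sub j y x
      have h3 := P.h_sub j y z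
      rw [P.grad_h] at h1 ⊢
      simp only [w, inner_add_right, real_inner_smul_right]
      rw [h1, ← h2, ← h3, P.h_zero]
      ring
    have := le_of_tendsto_of_tendsto ((hlim hFc).add hξ').norm ((hlim hFc).add (hlim hw)).norm hev
    rwa [hwx] at this
  have hfin : ∀ ζ ∈ feasibleVelocities g h α x, ‖F x + ξ‖ ≤ ‖F x + ζ‖ := by
    intro ζ hζ
    have hc : Continuous fun s : ℝ => ‖F x + ((1 - s) • ζ + s • (α • (z - x)))‖ := by fun_prop
    have ht : Tendsto (fun s : ℝ => ‖F x + ((1 - s) • ζ + s • (α • (z - x)))‖) (𝓝[>] 0)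
        (𝓝 ‖F x + ζ‖) := by
      have := (hc.tendsto 0).mono_left (nhdsWithin_le_nhds (s := Ioi 0))
      simpa using this
    refine ge_of_tendsto ht ?_
    filter_upwards [Ioo_mem_nhdsGT zero_lt_one] with s hs using hle ζ hζ s hs
  have : ξ = G x := (P.isClosestVelocity_flowField x).of_norm_le hmem
    (hfin _ (P.isClosestVelocity_flowField x).1)
  rwa [← this]

/-- The Karush-Kuhn-Tucker conditions for the closest feasible velocity. -/
lemma exists_multipliers_flowField (P : IsSlaterProblem F g h r α z) (x : Vec n) :
    ∃ (u : Fin m → ℝ) (v : Fin k → ℝ), (∀ i, 0 ≤ u i) ∧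
      (∀ i, u i * (inner ℝ (gradient (g i) x) (flowField F g h α x) + α * g i x) = 0) ∧
      flowField F g h α x = controlField F g h x u v := by
  obtain ⟨hmem, hmin⟩ := P.isClosestVelocity_flowField x
  set ξ := flowField F g h α x with hξ
  set I : Set (Fin m) := {i | inner ℝ (gradient (g i) x) ξ = -α * g i x} with hI
  -- The Slater velocity minus `ξ` strictly decreases all velocity constraints active at `ξ`, as
  -- Farkas' lemma requires.
  obtain ⟨u, v, hu, huI, huv⟩ := exists_multipliers (a := fun i => gradient (g i) x)
    (r := fun j => gradient (h j) x) (I := I) (d := α • (z - x) - ξ) (z := -(F x + ξ))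
    (fun i hi => by
      rw [inner_sub_right]
      have := P.inner_slater_lt x i
      rw [hI, mem_ofPred_eq] at hi
      linarith)
    (fun j => by
      rw [inner_sub_right, hmem.2 j, (P.smul_sub_mem P.slater_mem x).2 j, sub_self])
    (fun ζ hζ1 hζ2 => by
      have hev : ∀ᶠ s in 𝓝[>] (0 : ℝ), ξ + s • ζ ∈ feasibleVelocities g h α x := by
        have hi : ∀ i, ∀ᶠ s in 𝓝[>] (0 : ℝ),
            inner ℝ (gradient (g i) x) (ξ + s • ζ) ≤ -α * g i x := by
          intro i
          by_cases hiI : i ∈ I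
          · filter_upwards [self_mem_nhdsWithin] with s hs
            rw [inner_add_right, real_inner_smul_right]
            have := mul_nonpos_of_nonneg_of_nonpos (le_of_lt hs) (hζ1 i hiI)
            linarith [hmem.1 i]
          · have hlt := lt_of_le_of_ne (hmem.1 i) hiI
            have hc : Continuous fun s : ℝ => inner ℝ (gradient (g i) x) (ξ + s • ζ) := by fun_prop
            have := (hc.tendsto 0).mono_left (nhdsWithin_le_nhds (s := Ioi 0))
            rw [zero_smul, add_zero] at this
            filter_upwards [this.eventually (gt_mem_nhds hlt)] with s hs using hs.le
        filter_upwards [eventually_all.2 hi] with s hs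
        refine ⟨hs, fun j => ?_⟩
        rw [inner_add_right, real_inner_smul_right, hζ2 j, mul_zero, add_zero, hmem.2 j]
      obtain ⟨s, hs, hs0⟩ := (hev.and self_mem_nhdsWithin).exists
      have := hmin _ hs
      rw [add_sub_cancel_left, real_inner_smul_right] at this
      rw [inner_neg_left]
      have := nonneg_of_mul_nonneg_right this hs0
      linarith)
  refine ⟨u, v, hu, fun i => ?_, controlField_eq_iff.2 huv⟩
  by_cases hi : i ∈ I
  · rw [hI, mem_ofPred_eq] at hi
    rw [hi]; ring
  · rw [huI i hi, zero_mul]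

/-- The safe monotone flow is the vector field `flowField`. -/
lemma safeMonotoneFlow_eq (P : IsSlaterProblem F g h r α z) (x : Vec n) :
    safeMonotoneFlow F g h α x = {flowField F g h α x} := by
  obtain ⟨u, v, hu, -, huv⟩ := P.exists_multipliers_flowField x
  have hmem := (P.isClosestVelocity_flowField x).1
  have hK : ∀ p ∈ Kcbf F g h α x, controlField F g h x p.1 p.2 ∈ feasibleVelocities g h α x :=
    fun p hp => hp.2
  -- The input cost depends on the input only through its velocity, as half the squared distance to
  -- `-F x`; uniqueness of the projection therefore applies.
  have hcost : ∀ p : (Fin m → ℝ) × (Fin k → ℝ),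
      inputCost g h x p = (1 / 2) * ‖F x + controlField F g h x p.1 p.2‖ ^ 2 := by
    intro p
    rw [inputCost, ← controlField_eq_iff.1 rfl, norm_neg]
  have hp0 : (u, v) ∈ Kcbf F g h α x := by
    refine ⟨hu, ?_⟩
    rw [huv] at hmem
    exact hmem
  ext ξ
  rw [mem_singleton_iff]
  constructor
  · rintro ⟨p, hp, hmin, rfl⟩
    refine (P.isClosestVelocity_flowField x).of_norm_le (hK p hp) ?_
    have h1 : inputCost g h x p ≤ inputCost g h x (u, v) := hmin hp0
    rw [hcost, hcost, ← huv] at h1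
    exact le_of_sq_le_sq (by linarith) (norm_nonneg _)
  · rintro rfl
    refine ⟨(u, v), hp0, fun p hp => ?_, huv⟩
    have h1 := P.norm_flowField_le (hK p hp)
    rw [mem_ofPred_eq, hcost, hcost, ← huv]
    gcongr

/-- A solution of the variational inequality is a zero of the field. -/
lemma flowField_eq_zero (P : IsSlaterProblem F g h r α z) {p : Vec n}
    (hp : p ∈ SOL F (constraintSet g h)) : flowField F g h α p = 0 := by
  obtain ⟨hpC, hVI⟩ := hp
  have h0 : (0 : Vec n) ∈ feasibleVelocities g h α p := by
    have := P.smul_sub_mem hpC p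
    simpa using this
  have hnonneg : ∀ ζ ∈ feasibleVelocities g h α p, 0 ≤ inner ℝ ζ (F p) := by
    intro ζ hζ
    -- A velocity feasible at `p` need not point into the constraint set, but mixed with a fraction
    -- `s` of the Slater velocity it does for a short time `τ`. The variational inequality applies
    -- there, and then `s → 0`.
    have hs : ∀ s ∈ Ioo (0 : ℝ) 1, 0 ≤ inner ℝ ((1 - s) • ζ + s • (α • (z - p))) (F p) := by
      intro s hs
      set w := (1 - s) • ζ + s • (α • (z - p)) with hw
      have hgi : ∀ i, ∀ᶠ τ in 𝓝[>] (0 : ℝ), g i (p + τ • w) < 0 := by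
        intro i
        refine eventually_line_neg (P.diff_g i) (hpC.1 i) fun hgp => ?_
        rw [hw, inner_add_right, real_inner_smul_right, real_inner_smul_right]
        have h1 := mul_le_mul_of_nonneg_left (hζ.1 i) (sub_nonneg.2 hs.2.le)
        have h2 := mul_lt_mul_of_pos_left (P.inner_slater_lt p i) hs.1
        rw [hgp] at h1 h2
        linarith
      obtain ⟨τ, hτ, hτ0⟩ := ((eventually_all.2 hgi).and self_mem_nhdsWithin).exists
      have hC : p + τ • w ∈ constraintSet g h := by
        refine ⟨fun i => (hτ i).le, fun j => ?_⟩
        have h1 := P.h_sub j p (p + τ • w)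
        have h2 := hζ.2 j
        have h3 := (P.smul_sub_mem P.slater_mem p).2 j
        rw [P.grad_h, hpC.2 j] at h2 h3
        rw [add_sub_cancel_left, real_inner_smul_right, hw, inner_add_right,
          real_inner_smul_right, real_inner_smul_right, h2, h3, hpC.2 j] at h1
        linarith
      have := hVI _ hC
      rw [add_sub_cancel_left, real_inner_smul_left] at this
      exact nonneg_of_mul_nonneg_right this hτ0
    have hc : Continuous fun s : ℝ => inner ℝ ((1 - s) • ζ + s • (α • (z - p))) (F p) := by fun_prop
    have ht := (hc.tendsto 0).mono_left (nhdsWithin_le_nhds (s := Ioi 0))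
    simp only [sub_zero, one_smul, zero_smul, add_zero] at ht
    refine ge_of_tendsto ht ?_
    filter_upwards [Ioo_mem_nhdsGT zero_lt_one] with s hs' using hs s hs'
  have hcl : IsClosestVelocity F g h α p 0 :=
    ⟨h0, fun ζ hζ => by
      rw [add_zero, sub_zero, real_inner_comm]; exact hnonneg ζ hζ⟩
  exact hcl.of_norm_le (P.isClosestVelocity_flowField p).1 (P.norm_flowField_le h0)

end IsSlaterProblem

/-! ### Forward completeness from boundedness of solutions -/

lemma isSolutionOn_singleton_iff {G : Vec n → Vec n} {x : ℝ → Vec n} {S : Set ℝ} :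
    IsSolutionOn (fun y => {G y}) x S ↔ ∀ t ∈ S, HasDerivWithinAt x (G (x t)) S t := by
  simp [IsSolutionOn]

lemma IsSolutionOn.mono {G : Vec n → Set (Vec n)} {x : ℝ → Vec n} {S S' : Set ℝ}
    (hx : IsSolutionOn G x S) (h : S' ⊆ S) : IsSolutionOn G x S' := fun t ht =>
  let ⟨ξ, hξ, hd⟩ := hx t (h ht)
  ⟨ξ, hξ, hd.mono h⟩

lemma exists_norm_le_on_closedBall {G : Vec n → Vec n} (hG : Continuous G) (p : Vec n) (R : ℝ) :
    ∃ M > 0, ∀ y, ‖y - p‖ ≤ R → ‖G y‖ ≤ M := by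
  obtain ⟨M, hM⟩ := (isCompact_closedBall p R).exists_bound_of_continuousOn hG.continuousOn
  exact ⟨max M 1, by positivity,
    fun y hy => (hM y (mem_closedBall_iff_norm.2 hy)).trans (le_max_left _ _)⟩

lemma exists_global_solution {G : Vec n → Vec n} (hG : Continuous G) {p : Vec n}
    (hb : SolutionsBounded (fun y => {G y}) p) (x₀ : Vec n) :
    ∃ x, IsSolutionOn (fun y => {G y}) x (Ici 0) ∧ x 0 = x₀ := by
  obtain ⟨R₀, hR₀⟩ := hb ‖x₀ - p‖
  set R := max R₀ ‖x₀ - p‖ with hR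
  obtain ⟨M, hM0, hM⟩ := exists_norm_le_on_closedBall hG p (R + 1)
  -- The field is rescaled to norm at most `M`, unchanged on the ball of radius `R + 1`, so that
  -- Peano's theorem applies.
  let G' : Vec n → Vec n := fun y => (M / max M ‖G y‖) • G y
  have hpos : ∀ y, 0 < max M ‖G y‖ := fun y => lt_max_of_lt_left hM0
  have hG'c : Continuous G' := by
    refine Continuous.smul (Continuous.div continuous_const (by fun_prop) fun y => (hpos y).ne') hG
  have hG'M : ∀ y, ‖G' y‖ ≤ M := by
    intro y
    simp only [G']
    rw [norm_smul, Real.norm_of_nonneg (by have := hpos y; positivity), div_mul_eq_mul_div,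
      div_le_iff₀ (hpos y)]
    exact mul_le_mul_of_nonneg_left (le_max_right _ _) hM0.le
  have hG'eq : ∀ y, ‖y - p‖ ≤ R + 1 → G' y = G y := by
    intro y hy
    simp only [G']
    rw [max_eq_left (hM y hy), div_self hM0.ne', one_smul]
  obtain ⟨x, hx0, hx⟩ := exists_solution_of_bounded hG'c hG'M x₀
  have hcont : ContinuousOn x (Ici 0) := fun t ht => (hx t ht).continuousWithinAt
  -- At a first exit time from the larger ball the curve would still be a limit of points of a
  -- genuine solution, hence within `R₀ ≤ R` of `p`.
  have hstay : ∀ t, 0 ≤ t → ‖x t - p‖ < R + 1 := by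
    by_contra! hcon
    set S : Set ℝ := Ici 0 ∩ (fun t => ‖x t - p‖) ⁻¹' Ici (R + 1) with hS
    have hSne : S.Nonempty := let ⟨t, ht, h⟩ := hcon; ⟨t, ht, h⟩
    have hSbdd : BddBelow S := ⟨0, fun t ht => ht.1⟩
    have hSc : IsClosed S :=
      (hcont.sub continuousOn_const).norm.preimage_isClosed_of_isClosed isClosed_Ici isClosed_Ici
    obtain ⟨ht0, htR⟩ : sInf S ∈ S := hSc.csInf_mem hSne hSbdd
    set t₁ := sInf S with ht₁
    have hxR : R + 1 ≤ ‖x t₁ - p‖ := htR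
    have ht₁0 : 0 < t₁ := by
      refine lt_of_le_of_ne ht0 fun h => ?_
      rw [← h, hx0] at hxR
      linarith [le_max_right R₀ ‖x₀ - p‖]
    have hlt : ∀ t ∈ Ico 0 t₁, ‖x t - p‖ < R + 1 := by
      intro t ht
      by_contra! h
      exact absurd (csInf_le hSbdd (show t ∈ S from ⟨ht.1, h⟩)) (not_le.2 ht.2)
    have hsol : IsSolutionOn (fun y => {G y}) x (Ico 0 t₁) := by
      rw [isSolutionOn_singleton_iff]
      intro t ht
      rw [← hG'eq _ (hlt t ht).le]
      exact (hx t ht.1).mono Ico_subset_Ici_self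
    have hle := hR₀ t₁ ht₁0 x hsol (by rw [hx0])
    have hlim : Tendsto (fun t => ‖x t - p‖) (𝓝[<] t₁) (𝓝 ‖x t₁ - p‖) := by
      have h1 : ContinuousWithinAt (fun t => ‖x t - p‖) (Ici 0) t₁ :=
        ((hcont.sub continuousOn_const).norm) t₁ ht0
      exact h1.mono_left (nhdsWithin_le_of_mem (mem_nhdsWithin_of_mem_nhds (Ici_mem_nhds ht₁0)))
    have : ‖x t₁ - p‖ ≤ R₀ := by
      refine le_of_tendsto hlim ?_
      filter_upwards [Ico_mem_nhdsLT ht₁0] with t ht using hle t ht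
    linarith [le_max_left R₀ ‖x₀ - p‖]
  refine ⟨x, ?_, hx0⟩
  rw [isSolutionOn_singleton_iff]
  intro t ht
  rw [← hG'eq _ (hstay t ht).le]
  exact hx t ht

/-- A solution on `[0, T)` with bounded velocity, followed from its end point by a solution on
`[0, ∞)`, is a solution. -/
lemma exists_extension {G : Vec n → Vec n} (hG : Continuous G)
    (hex : ∀ x₀, ∃ x, IsSolutionOn (fun y => {G y}) x (Ici 0) ∧ x 0 = x₀) {T M : ℝ} (hT : 0 < T)
    (hM : 0 ≤ M) {x : ℝ → Vec n} (hx : IsSolutionOn (fun y => {G y}) x (Ico 0 T))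
    (hbound : ∀ t ∈ Ico 0 T, ‖G (x t)‖ ≤ M) :
    ∃ y, IsSolutionOn (fun y => {G y}) y (Ici 0) ∧ EqOn y x (Ico 0 T) := by
  rw [isSolutionOn_singleton_iff] at hx
  -- Bounded velocity makes `x` Lipschitz, so it has a limit at `T`, read off from a Lipschitz
  -- extension `e`; the continuation starts there.
  have hLip : LipschitzOnWith ⟨M, hM⟩ x (Ico 0 T) :=
    (convex_Ico 0 T).lipschitzOnWith_of_nnnorm_hasDerivWithin_le hx fun t ht => hbound t ht
  obtain ⟨e, he, hxe⟩ := hLip.extend_finite_dimension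
  obtain ⟨q, hq, hq0⟩ := hex (e T)
  rw [isSolutionOn_singleton_iff] at hq
  let w : ℝ → Vec n := fun t => if t < T then x t else q (t - T)
  have hw1 : ∀ t, t < T → w t = x t := fun t ht => if_pos ht
  have hw2 : ∀ t, T ≤ t → w t = q (t - T) := fun t ht => if_neg (not_lt.2 ht)
  refine ⟨w, ?_, fun t ht => hw1 t ht.2⟩
  rw [isSolutionOn_singleton_iff]
  have hleft : ∀ t ∈ Ico 0 T, HasDerivWithinAt w (G (w t)) (Ici 0) t := by
    intro t ht
    have hnhds : Ico 0 T ∈ 𝓝[Ici 0] t := by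
      have : Ici 0 ∩ Iio T ∈ 𝓝[Ici 0] t :=
        inter_mem_nhdsWithin _ (Iio_mem_nhds ht.2)
      rwa [Ici_inter_Iio] at this
    rw [hw1 t ht.2]
    exact ((hx t ht).congr (fun s hs => hw1 s hs.2) (hw1 t ht.2)).mono_of_mem_nhdsWithin hnhds
  have hright : ∀ t, T ≤ t → HasDerivWithinAt w (G (w t)) (Ici T) t := by
    intro t ht
    have h1 : HasDerivWithinAt (fun s => q (s - T)) (G (q (t - T))) (Ici T) t := by
      have h2 := HasDerivWithinAt.scomp t (hq (t - T) (sub_nonneg.2 ht))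
        ((hasDerivWithinAt_id t (Ici T)).sub_const T)
        (fun s hs => show (0 : ℝ) ≤ id s - T from sub_nonneg.2 hs : MapsTo (fun s => id s - T) (Ici T) (Ici 0))
      rw [one_smul] at h2
      exact h2
    rw [hw2 t ht]
    exact h1.congr (fun s hs => hw2 s hs) (hw2 t ht)
  intro t ht
  rcases lt_trichotomy t T with htT | rfl | htT
  · exact hleft t ⟨ht, htT⟩
  · have hwt : w t = e t := by rw [hw2 t le_rfl, sub_self, hq0]
    have hwe : ∀ s ∈ Ioo 0 t, w s = e s := fun s hs => by
      rw [hw1 s hs.2]; exact hxe ⟨hs.1.le, hs.2⟩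
    have hderiv : ∀ s ∈ Ioo 0 t, HasDerivAt w (G (e s)) s := by
      intro s hs
      rw [← hwe s hs]
      exact (hleft s ⟨hs.1.le, hs.2⟩).hasDerivAt (Ici_mem_nhds hs.1)
    -- At the junction the left derivative comes from the limit of the derivatives, using continuity
    -- of `G`; it agrees with the right derivative of the continuation.
    have hIic : HasDerivWithinAt w (G (w t)) (Iic t) t := by
      refine hasDerivWithinAt_Iic_of_tendsto_deriv (s := Ioo 0 t)
        (fun s hs => (hderiv s hs).differentiableAt.differentiableWithinAt) ?_
        (Ioo_mem_nhdsLT hT) ?_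
      · exact (he.continuous.continuousWithinAt).congr hwe hwt
      · rw [hwt]
        have hc : Tendsto (fun s => G (e s)) (𝓝[<] t) (𝓝 (G (e t))) :=
          ((hG.comp he.continuous).tendsto t).mono_left nhdsWithin_le_nhds
        refine hc.congr' ?_
        filter_upwards [Ioo_mem_nhdsLT hT] with s hs using (hderiv s hs).deriv.symm
    have := hIic.union (hright t le_rfl)
    rw [Iic_union_Ici] at this
    exact this.mono (subset_univ _)
  · exact (hright t htT.le).mono_of_mem_nhdsWithin (mem_nhdsWithin_of_mem_nhds (Ici_mem_nhds htT))

theorem forwardComplete_of_solutionsBounded {G : Vec n → Vec n} (hG : Continuous G) {p : Vec n}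
    (hb : SolutionsBounded (fun y => {G y}) p) : ForwardComplete (fun y => {G y}) := by
  refine ⟨exists_global_solution hG hb, fun T hT x hx => ?_⟩
  obtain ⟨R, hR⟩ := hb ‖x 0 - p‖
  obtain ⟨M, hM0, hM⟩ := exists_norm_le_on_closedBall hG p R
  exact exists_extension hG (exists_global_solution hG hb) hT hM0.le hx fun t ht =>
    hM _ (hR T hT x hx le_rfl t ht)

/-! ### The Lyapunov function -/

/-- The linear combination `∑ᵢ uᵢ gᵢ(x) + ∑ⱼ vⱼ hⱼ(x)` of the constraints. -/
def constraintSum (g : Fin m → Vec n → ℝ) (h : Fin k → Vec n → ℝ) (u : Fin m → ℝ) (v : Fin k → ℝ)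
    (x : Vec n) : ℝ :=
  ∑ i, u i * g i x + ∑ j, v j * h j x

/-- The minimum of `F(x)ᵀ ζ + ½ ‖ζ‖²` over the feasible velocities `ζ`. -/
def flowValue (F : Vec n → Vec n) (g : Fin m → Vec n → ℝ) (h : Fin k → Vec n → ℝ) (α : ℝ)
    (x : Vec n) : ℝ :=
  inner ℝ (F x) (flowField F g h α x) + (1 / 2) * ‖flowField F g h α x‖ ^ 2

/-- The squared distance to `p`, corrected by the negative part of `flowValue`. -/
def energy (F : Vec n → Vec n) (g : Fin m → Vec n → ℝ) (h : Fin k → Vec n → ℝ) (α : ℝ)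
    (p x : Vec n) : ℝ :=
  (1 / 2) * ‖x - p‖ ^ 2 + max (-flowValue F g h α x) 0 / α ^ 2

lemma inner_inputTerm (g : Fin m → Vec n → ℝ) (h : Fin k → Vec n → ℝ) (x : Vec n)
    (u : Fin m → ℝ) (v : Fin k → ℝ) (ζ : Vec n) :
    inner ℝ (inputTerm g h x u v) ζ =
      ∑ i, u i * inner ℝ (gradient (g i) x) ζ + ∑ j, v j * inner ℝ (gradient (h j) x) ζ := by
  simp only [inputTerm, inner_add_left, sum_inner, real_inner_smul_left]

lemma locallyLipschitz_const_smul {f : Vec n → Vec n} (hf : LocallyLipschitz f) (a : ℝ) :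
    LocallyLipschitz fun x => a • f x :=
  (lipschitzWith_smul a).locallyLipschitz.comp hf

lemma locallyLipschitz_sum {ι : Type*} (s : Finset ι) {f : ι → Vec n → Vec n}
    (hf : ∀ i, LocallyLipschitz (f i)) : LocallyLipschitz fun x => ∑ i ∈ s, f i x := by
  classical
  induction s using Finset.induction_on with
  | empty => simpa using LocallyLipschitz.const (0 : Vec n)
  | insert i s his ih =>
    simp only [Finset.sum_insert his]
    exact (hf i).add ih

/-! ### Duality and differential inequalities along solutions -/

namespace IsSlaterProblem

variable {F : Vec n → Vec n} {g : Fin m → Vec n → ℝ} {h : Fin k → Vec n → ℝ}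
  {r : Fin k → Vec n} {α : ℝ} {z p : Vec n}

lemma continuous_constraintSum (P : IsSlaterProblem F g h r α z) (u : Fin m → ℝ) (v : Fin k → ℝ) :
    Continuous (constraintSum g h u v) := by
  have hgc : ∀ i, Continuous (g i) := fun i => (P.diff_g i).continuous
  have hhc : ∀ j, Continuous (h j) := fun j => (P.differentiable_h j).continuous
  unfold constraintSum
  fun_prop

lemma continuous_flowValue (P : IsSlaterProblem F g h r α z) :
    Continuous (flowValue F g h α) := by
  have hF := P.lip_F.continuous
  have hG := P.continuous_flowField
  unfold flowValue
  fun_prop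

lemma continuous_energy (P : IsSlaterProblem F g h r α z) (p : Vec n) :
    Continuous (energy F g h α p) := by
  have := P.continuous_flowValue
  unfold energy
  fun_prop

lemma hasDerivWithinAt_constraintSum (P : IsSlaterProblem F g h r α z) (u : Fin m → ℝ)
    (v : Fin k → ℝ) {x : ℝ → Vec n} {ξ : Vec n} {S : Set ℝ} {t : ℝ}
    (hx : HasDerivWithinAt x ξ S t) :
    HasDerivWithinAt (fun s => constraintSum g h u v (x s))
      (inner ℝ (inputTerm g h (x t) u v) ξ) S t := by
  rw [inner_inputTerm]
  exact (HasDerivWithinAt.fun_sum fun i _ =>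
      (hasDerivWithinAt_comp_gradient (P.diff_g i) hx).const_mul (u i)).add
    (HasDerivWithinAt.fun_sum fun j _ =>
      (hasDerivWithinAt_comp_gradient (P.differentiable_h j) hx).const_mul (v j))

lemma inner_inputTerm_le {u : Fin m → ℝ} (hu : ∀ i, 0 ≤ u i)
    (v : Fin k → ℝ) {x ζ : Vec n} (hζ : ζ ∈ feasibleVelocities g h α x) :
    inner ℝ (inputTerm g h x u v) ζ ≤ -α * constraintSum g h u v x := by
  have h1 : ∑ i, u i * inner ℝ (gradient (g i) x) ζ ≤ ∑ i, -α * (u i * g i x) :=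
    Finset.sum_le_sum fun i _ => by
      have := mul_le_mul_of_nonneg_left (hζ.1 i) (hu i)
      linarith
  have h2 : ∑ j, v j * inner ℝ (gradient (h j) x) ζ = ∑ j, -α * (v j * h j x) :=
    Finset.sum_congr rfl fun j _ => by rw [hζ.2 j]; ring
  rw [inner_inputTerm, constraintSum, mul_add, Finset.mul_sum, Finset.mul_sum]
  linarith

/-- Weak duality for the minimization defining the velocity. -/
lemma dual_le_flowValue (P : IsSlaterProblem F g h r α z) {u : Fin m → ℝ} (hu : ∀ i, 0 ≤ u i)
    (v : Fin k → ℝ) (y : Vec n) :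
    -(1 / 2) * ‖F y + inputTerm g h y u v‖ ^ 2 + α * constraintSum g h u v y
      ≤ flowValue F g h α y := by
  have h1 := inner_inputTerm_le hu v (P.isClosestVelocity_flowField y).1
  have h2 := sq_nonneg ‖(F y + inputTerm g h y u v) + flowField F g h α y‖
  rw [norm_add_sq_real (F y + inputTerm g h y u v), inner_add_left] at h2
  rw [flowValue]
  linarith

/-- With fixed multipliers `u ≥ 0`, gradients of convex functions add monotone terms, and the affine
constraints add only a constant. -/
lemma monotone_add_inputTerm (P : IsSlaterProblem F g h r α z) (hF : IsMonotoneMap F)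
    {u : Fin m → ℝ} (hu : ∀ i, 0 ≤ u i) (v : Fin k → ℝ) (x y : Vec n) :
    0 ≤ inner ℝ (x - y) ((F x + inputTerm g h x u v) - (F y + inputTerm g h y u v)) := by
  have e : (F x + inputTerm g h x u v) - (F y + inputTerm g h y u v)
      = (F x - F y) + ∑ i, u i • (gradient (g i) x - gradient (g i) y) := by
    simp only [inputTerm, P.grad_h, smul_sub, Finset.sum_sub_distrib]
    abel
  rw [e, inner_add_right, inner_sum]
  refine add_nonneg (hF x y) (Finset.sum_nonneg fun i _ => ?_)
  rw [real_inner_smul_right]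
  exact mul_nonneg (hu i) (inner_gradient_sub_nonneg (P.diff_g i) (P.convex_g i) x y)

lemma locallyLipschitz_add_inputTerm (P : IsSlaterProblem F g h r α z) (u : Fin m → ℝ)
    (v : Fin k → ℝ) : LocallyLipschitz fun x => F x + inputTerm g h x u v := by
  simp only [inputTerm, P.grad_h]
  exact P.lip_F.add ((locallyLipschitz_sum _ fun i =>
    locallyLipschitz_const_smul (P.lip_grad i) (u i)).add (LocallyLipschitz.const _))

/-- The lower right derivative of `flowValue` along a solution. -/
lemma eventually_flowValue_ge (P : IsSlaterProblem F g h r α z) (hF : IsMonotoneMap F)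
    {x : ℝ → Vec n} {t : ℝ} (hx : HasDerivWithinAt x (flowField F g h α (x t)) (Ioi t) t)
    {ε : ℝ} (hε : 0 < ε) :
    ∀ᶠ s in 𝓝[>] t, flowValue F g h α (x t) -
      (α * (flowValue F g h α (x t) + (1 / 2) * ‖flowField F g h α (x t)‖ ^ 2) + ε) * (s - t)
        ≤ flowValue F g h α (x s) := by
  obtain ⟨u, v, hu, hcompl, huv⟩ := P.exists_multipliers_flowField (x t)
  have hmem := (P.isClosestVelocity_flowField (x t)).1
  set ξ := flowField F g h α (x t) with hξ
  have hterm : inputTerm g h (x t) u v = -(F (x t) + ξ) := (controlField_eq_iff.1 huv).symm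
  have hN : F (x t) + inputTerm g h (x t) u v = -ξ := by rw [hterm]; abel
  have hinner : inner ℝ (inputTerm g h (x t) u v) ξ = -α * constraintSum g h u v (x t) := by
    rw [inner_inputTerm, constraintSum, mul_add, Finset.mul_sum, Finset.mul_sum]
    congr 1
    · refine Finset.sum_congr rfl fun i _ => ?_
      linarith [hcompl i]
    · refine Finset.sum_congr rfl fun j _ => ?_
      rw [hmem.2 j]; ring
  have hinner' : inner ℝ (inputTerm g h (x t) u v) ξ
      = -(flowValue F g h α (x t) + (1 / 2) * ‖ξ‖ ^ 2) := by
    rw [hterm, inner_neg_left, inner_add_left, real_inner_self_eq_norm_sq, flowValue, ← hξ]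
    ring
  -- With `u`, `v` frozen at time `t`, the velocity at `t` is minus this monotone field, so the
  -- quadratic part of the dual bound does not decrease to first order.
  have hsq := eventually_norm_sq_le_of_monotone (N := fun y => F y + inputTerm g h y u v)
    (P.monotone_add_inputTerm hF hu v) (P.locallyLipschitz_add_inputTerm u v) (x := x) (t := t)
    (by simpa only [hN, neg_neg] using hx) hε
  have hcs := P.hasDerivWithinAt_constraintSum u v hx
  have hlo := (Asymptotics.isLittleO_iff.1 (hasDerivWithinAt_iff_isLittleO.1 hcs))
    (show 0 < ε / (2 * α) by have := P.alpha_pos; positivity)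
  filter_upwards [hsq, hlo, self_mem_nhdsWithin] with s h1 h2 hs
  have hst : 0 < s - t := sub_pos.2 hs
  have h3 := P.dual_le_flowValue hu v (x s)
  rw [hN, norm_neg] at h1
  rw [hinner', Real.norm_of_nonneg hst.le, Real.norm_eq_abs, smul_eq_mul] at h2
  have h4 := mul_le_mul_of_nonneg_left (neg_le_of_abs_le h2) P.alpha_pos.le
  have e4 : α * -(ε / (2 * α) * (s - t)) = -(ε / 2 * (s - t)) := by
    have := P.alpha_pos.ne'
    field_simp
  rw [e4] at h4
  have h5 : α * constraintSum g h u v (x t) = flowValue F g h α (x t) + (1 / 2) * ‖ξ‖ ^ 2 := by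
    linarith
  linarith

/-- The variational inequality of the projection, tested with the admissible velocity `α • (p - x)`.
-/
lemma inner_sub_flowField_le (P : IsSlaterProblem F g h r α z) (hp : p ∈ constraintSet g h)
    (x : Vec n) :
    inner ℝ (x - p) (flowField F g h α x) ≤ -inner ℝ (x - p) (F x) -
      (flowValue F g h α x + (1 / 2) * ‖flowField F g h α x‖ ^ 2) / α := by
  have h1 := (P.isClosestVelocity_flowField x).2 _ (P.smul_sub_mem hp x)
  set ξ := flowField F g h α x with hξ
  have e : α • (p - x) = -(α • (x - p)) := by rw [← smul_neg, neg_sub]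
  rw [e, inner_sub_right, inner_neg_right, real_inner_smul_right, inner_add_left, inner_add_left,
    real_inner_self_eq_norm_sq, real_inner_comm, real_inner_comm (x - p) ξ] at h1
  rw [le_sub_iff_add_le, ← le_sub_iff_add_le', div_le_iff₀ P.alpha_pos, flowValue, ← hξ]
  linarith

/-- The multipliers at `p` turn `-F p` into a combination of constraint gradients; convexity bounds
each linearization at `p` by the constraint itself. -/
lemma neg_inner_le_constraintSum (P : IsSlaterProblem F g h r α z) (hp : p ∈ constraintSet g h)
    {u : Fin m → ℝ} {v : Fin k → ℝ} (hu : ∀ i, 0 ≤ u i) (hcompl : ∀ i, u i * g i p = 0)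
    (hFp : F p = -inputTerm g h p u v) (x : Vec n) :
    -inner ℝ (x - p) (F p) ≤ constraintSum g h u v x := by
  rw [hFp, inner_neg_right, neg_neg, real_inner_comm, inner_inputTerm, constraintSum]
  refine add_le_add (Finset.sum_le_sum fun i _ => ?_) (Finset.sum_le_sum fun j _ => ?_)
  · have h1 := add_inner_gradient_le (P.diff_g i) (P.convex_g i) p x
    have h2 := mul_le_mul_of_nonneg_left h1 (hu i)
    rw [mul_add, hcompl i] at h2
    linarith
  · rw [P.grad_h, ← P.h_sub, hp.2 j, sub_zero]

/-- Multipliers for the variational inequality at a solution. -/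
lemma exists_multipliers_sol (P : IsSlaterProblem F g h r α z)
    (hp : p ∈ SOL F (constraintSet g h)) :
    ∃ (u : Fin m → ℝ) (v : Fin k → ℝ), (∀ i, 0 ≤ u i) ∧ (∀ i, u i * g i p = 0) ∧
      F p = -inputTerm g h p u v := by
  obtain ⟨u, v, hu, hcompl, huv⟩ := P.exists_multipliers_flowField p
  -- With zero velocity at `p`, the KKT system of the projection becomes that of the variational
  -- inequality.
  rw [P.flowField_eq_zero hp] at hcompl huv
  refine ⟨u, v, hu, fun i => ?_, ?_⟩
  · have h1 := hcompl i
    rw [inner_zero_right, zero_add, mul_left_comm] at h1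
    exact (mul_eq_zero.1 h1).resolve_left P.alpha_pos.ne'
  · rw [← controlField_eq_iff.1 huv, add_zero, neg_neg]

/-- The upper right derivative of the energy along a solution. -/
lemma eventually_energy_le (P : IsSlaterProblem F g h r α z) (hF : IsMonotoneMap F)
    (hp : p ∈ constraintSet g h) {x : ℝ → Vec n} {t C c : ℝ}
    (hx : HasDerivWithinAt x (flowField F g h α (x t)) (Ioi t) t)
    (hC : -inner ℝ (x t - p) (F p) ≤ C) (hc : c ≤ inner ℝ (x t - p) (F (x t) - F p))
    {ε : ℝ} (hε : 0 < ε) :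
    ∀ᶠ s in 𝓝[>] t, energy F g h α p (x s) ≤ energy F g h α p (x t) + (C - c + ε) * (s - t) := by
  have hα := P.alpha_pos
  have hA : HasDerivWithinAt (fun s => (1 / 2) * ‖x s - p‖ ^ 2)
      (inner ℝ (x t - p) (flowField F g h α (x t))) (Ioi t) t := by
    have := ((hx.sub_const p).norm_sq).const_mul (1 / 2 : ℝ)
    refine this.congr_deriv ?_
    ring
  have hlo := (Asymptotics.isLittleO_iff.1 (hasDerivWithinAt_iff_isLittleO.1 hA)) (half_pos hε)
  have hle := P.inner_sub_flowField_le hp (x t)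
  rw [inner_sub_right] at hc
  set ξ := flowField F g h α (x t) with hξ
  set μ := flowValue F g h α (x t) with hμ
  -- After division by `α ^ 2` this error is `ε / 2`; the squared distance accounts for the other
  -- half.
  have hm := P.eventually_flowValue_ge hF hx (ε := ε / 2 * α ^ 2) (by positivity)
  rw [← hξ, ← hμ] at hm
  have hq : 0 ≤ ‖ξ‖ ^ 2 := sq_nonneg _
  -- the derivative of the squared distance
  have hdist : ∀ᶠ s in 𝓝[>] t, (1 / 2) * ‖x s - p‖ ^ 2 ≤ (1 / 2) * ‖x t - p‖ ^ 2 +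
      (C - c - (μ + (1 / 2) * ‖ξ‖ ^ 2) / α + ε / 2) * (s - t) := by
    filter_upwards [hlo, self_mem_nhdsWithin] with s h1 hs
    have hst : 0 < s - t := sub_pos.2 hs
    rw [Real.norm_of_nonneg hst.le, Real.norm_eq_abs, smul_eq_mul] at h1
    have h2 := le_of_abs_le h1
    have h3 : inner ℝ (x t - p) ξ * (s - t) ≤
        (C - c - (μ + (1 / 2) * ‖ξ‖ ^ 2) / α) * (s - t) := by
      gcongr; linarith
    linarith
  rcases le_or_gt μ 0 with hμ0 | hμ0
  · have hsmall : ∀ᶠ s in 𝓝[>] t, s - t < 1 / α := by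
      have : Tendsto (fun s : ℝ => s - t) (𝓝[>] t) (𝓝 (t - t)) :=
        ((continuous_id.sub continuous_const).tendsto t).mono_left nhdsWithin_le_nhds
      rw [sub_self] at this
      exact this.eventually (gt_mem_nhds (by positivity))
    filter_upwards [hdist, hm, self_mem_nhdsWithin, hsmall] with s h1 h2 hs h3
    have hst : 0 < s - t := sub_pos.2 hs
    have h4 : max (-flowValue F g h α (x s)) 0 ≤
        -μ + (α * (μ + (1 / 2) * ‖ξ‖ ^ 2) + ε / 2 * α ^ 2) * (s - t) := by
      refine max_le (by linarith) ?_
      have h5 : α * (s - t) < 1 := by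
        rw [lt_div_iff₀ hα] at h3; linarith
      have h6 : 0 ≤ (α * ((1 / 2) * ‖ξ‖ ^ 2) + ε / 2 * α ^ 2) * (s - t) := by positivity
      nlinarith
    have h5 : max (-flowValue F g h α (x s)) 0 / α ^ 2 ≤
        -μ / α ^ 2 + ((μ + (1 / 2) * ‖ξ‖ ^ 2) / α + ε / 2) * (s - t) := by
      rw [div_le_iff₀ (by positivity)]
      refine h4.trans (le_of_eq ?_)
      field_simp
    rw [energy, energy, ← hμ, max_eq_left (by linarith : (0 : ℝ) ≤ -μ)]
    linarith
  · have hpos : ∀ᶠ s in 𝓝[>] t, 0 < flowValue F g h α (x s) := by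
      have hcx : Tendsto x (𝓝[>] t) (𝓝 (x t)) := hx.continuousWithinAt
      exact ((P.continuous_flowValue.tendsto (x t)).comp hcx).eventually (lt_mem_nhds hμ0)
    filter_upwards [hdist, hpos, self_mem_nhdsWithin] with s h1 h2 hs
    have hst : 0 < s - t := sub_pos.2 hs
    rw [energy, energy, ← hμ, max_eq_right (by linarith), max_eq_right (by linarith)]
    have h3 : 0 ≤ (μ + (1 / 2) * ‖ξ‖ ^ 2) / α * (s - t) := by positivity
    have h4 : 0 ≤ ε / 2 * (s - t) := by positivity
    linarith

/-- Feasible velocities make the derivative of the combination at most `-α` times itself; `exp (α *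
s)` is the integrating factor. -/
lemma constraintSum_le (P : IsSlaterProblem F g h r α z) {u : Fin m → ℝ} (hu : ∀ i, 0 ≤ u i)
    (v : Fin k → ℝ) {x : ℝ → Vec n} {T : ℝ}
    (hx : ∀ t ∈ Ico 0 T, HasDerivWithinAt x (flowField F g h α (x t)) (Ico 0 T) t)
    {t : ℝ} (ht : t ∈ Ico 0 T) :
    constraintSum g h u v (x t) ≤ constraintSum g h u v (x 0) * Real.exp (-(α * t)) := by
  have hxc : ContinuousOn x (Icc 0 t) := fun s hs =>
    ((hx s ⟨hs.1, hs.2.trans_lt ht.2⟩).continuousWithinAt).mono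
      fun w hw => ⟨hw.1, hw.2.trans_lt ht.2⟩
  have hcs := (P.continuous_constraintSum u v).comp_continuousOn hxc
  have key := image_le_of_deriv_right_le_deriv_boundary (a := 0) (b := t)
    (f := fun s => constraintSum g h u v (x s) * Real.exp (α * s))
    (f' := fun s => inner ℝ (inputTerm g h (x s) u v) (flowField F g h α (x s)) * Real.exp (α * s)
      + constraintSum g h u v (x s) * (Real.exp (α * s) * α))
    (B := fun _ => constraintSum g h u v (x 0)) (B' := fun _ => 0)
    (hcs.mul (by fun_prop))
    (fun s hs => by
      have hd := (hx s ⟨hs.1, hs.2.trans ht.2⟩).mono_of_mem_nhdsWithin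
        (mem_of_superset (Ico_mem_nhdsGE (hs.2.trans ht.2)) fun w hw =>
          ⟨hs.1.trans hw.1, hw.2⟩ : Ico 0 T ∈ 𝓝[≥] s)
      have he : HasDerivAt (fun s => Real.exp (α * s)) (Real.exp (α * s) * α) s := by
        simpa using ((hasDerivAt_id s).const_mul α).exp
      exact (P.hasDerivWithinAt_constraintSum u v hd).mul he.hasDerivWithinAt)
    (by simp) continuousOn_const (fun s _ => hasDerivWithinAt_const _ _ _)
    (fun s _ => by
      have h1 := inner_inputTerm_le hu v (P.isClosestVelocity_flowField (x s)).1
      have h2 := mul_le_mul_of_nonneg_right h1 (Real.exp_pos (α * s)).le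
      linarith)
    (right_mem_Icc.2 ht.1)
  rw [Real.exp_neg, ← div_eq_mul_inv, le_div_iff₀ (Real.exp_pos _)]
  exact key

/-- The a priori bound for solutions of the flow. -/
lemma energy_le (P : IsSlaterProblem F g h r α z) (hF : IsMonotoneMap F)
    (hp : p ∈ constraintSet g h) {u : Fin m → ℝ} {v : Fin k → ℝ} (hu : ∀ i, 0 ≤ u i)
    (hcompl : ∀ i, u i * g i p = 0) (hFp : F p = -inputTerm g h p u v) {x : ℝ → Vec n} {T c : ℝ}
    (hx : ∀ t ∈ Ico 0 T, HasDerivWithinAt x (flowField F g h α (x t)) (Ico 0 T) t)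
    {t : ℝ} (ht : t ∈ Ico 0 T)
    (hc : ∀ s ∈ Ico 0 t, c ≤ inner ℝ (x s - p) (F (x s) - F p)) :
    energy F g h α p (x t) ≤
      energy F g h α p (x 0) + max (constraintSum g h u v (x 0)) 0 / α - c * t := by
  have hα := P.alpha_pos
  set D := max (constraintSum g h u v (x 0)) 0 with hD
  have hD0 : 0 ≤ D := le_max_right _ _
  have hxc : ContinuousOn x (Icc 0 t) := fun s hs =>
    ((hx s ⟨hs.1, hs.2.trans_lt ht.2⟩).continuousWithinAt).mono
      fun w hw => ⟨hw.1, hw.2.trans_lt ht.2⟩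
  -- The energy is only continuous, so the comparison uses Dini derivatives. The barrier is the
  -- primitive of `D * exp (-(α * s)) - c` that starts at the initial energy.
  have key := image_le_of_liminf_slope_right_le_deriv_boundary (a := 0) (b := t)
    (f := fun s => energy F g h α p (x s))
    (B := fun s => energy F g h α p (x 0) + D / α * (1 - Real.exp (-(α * s))) - c * s)
    (B' := fun s => D * Real.exp (-(α * s)) - c)
    ((P.continuous_energy p).comp_continuousOn hxc) (by simp) (by fun_prop)
    (fun s _ => by
      have he : HasDerivAt (fun s => Real.exp (-(α * s))) (Real.exp (-(α * s)) * -α) s := by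
        simpa using (((hasDerivAt_id s).const_mul α).neg).exp
      have := (((he.const_sub 1).const_mul (D / α)).const_add (energy F g h α p (x 0))).sub
        ((hasDerivAt_id s).const_mul c)
      refine (this.congr_deriv ?_).hasDerivWithinAt
      field_simp)
    (fun s hs ρ hρ => by
      have hsT : s ∈ Ico 0 T := ⟨hs.1, hs.2.trans ht.2⟩
      have hd : HasDerivWithinAt x (flowField F g h α (x s)) (Ioi s) s :=
        (hx s hsT).mono_of_mem_nhdsWithin
          (mem_of_superset (Ioo_mem_nhdsGT hsT.2) fun w hw => ⟨hs.1.trans hw.1.le, hw.2⟩)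
      have hC : -inner ℝ (x s - p) (F p) ≤ D * Real.exp (-(α * s)) := by
        refine (P.neg_inner_le_constraintSum hp hu hcompl hFp (x s)).trans
          ((P.constraintSum_le hu v hx hsT).trans ?_)
        gcongr
        exact le_max_left _ _
      have hev := P.eventually_energy_le hF hp hd hC (hc s hs) (half_pos (sub_pos.2 hρ))
      refine Eventually.frequently ?_
      filter_upwards [hev, self_mem_nhdsWithin] with w hw hws
      have hst : 0 < w - s := sub_pos.2 hws
      rw [slope_def_field, div_lt_iff₀ hst]
      have : (D * Real.exp (-(α * s)) - c + (ρ - (D * Real.exp (-(α * s)) - c)) / 2) * (w - s)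
          < ρ * (w - s) := by
        gcongr; linarith
      linarith)
    (right_mem_Icc.2 ht.1)
  have h1 : D / α * (1 - Real.exp (-(α * t))) ≤ D / α * 1 := by
    gcongr
    linarith [Real.exp_pos (-(α * t))]
  linarith

end IsSlaterProblem

/-! ### Stability -/

namespace IsSlaterProblem

variable {F : Vec n → Vec n} {g : Fin m → Vec n → ℝ} {h : Fin k → Vec n → ℝ}
  {r : Fin k → Vec n} {α : ℝ} {z p : Vec n}

lemma flowValue_eq_zero (P : IsSlaterProblem F g h r α z) (hp : p ∈ SOL F (constraintSet g h)) :
    flowValue F g h α p = 0 := by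
  simp [flowValue, P.flowField_eq_zero hp]

/-- Along solutions, the distance to `p` is bounded by a continuous function of the initial state
that vanishes at `p`. -/
lemma exists_continuous_bound (P : IsSlaterProblem F g h r α z) (hF : IsMonotoneMap F)
    (hp : p ∈ SOL F (constraintSet g h)) :
    ∃ b : Vec n → ℝ, Continuous b ∧ b p = 0 ∧
      ∀ (T c : ℝ) (x : ℝ → Vec n),
        IsSolutionOn (fun y => {flowField F g h α y}) x (Ico 0 T) →
        ∀ t ∈ Ico 0 T, (∀ s ∈ Ico 0 t, c ≤ inner ℝ (x s - p) (F (x s) - F p)) →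
        (1 / 2) * ‖x t - p‖ ^ 2 ≤ b (x 0) - c * t := by
  obtain ⟨u, v, hu, hcompl, hFp⟩ := P.exists_multipliers_sol hp
  refine ⟨fun y => energy F g h α p y + max (constraintSum g h u v y) 0 / α, ?_, ?_, ?_⟩
  · have h1 := P.continuous_energy p
    have h2 := P.continuous_constraintSum u v
    fun_prop
  · have : constraintSum g h u v p = 0 := by
      simp [constraintSum, hcompl, hp.1.2]
    simp [energy, P.flowValue_eq_zero hp, this]
  · intro T c x hx t ht hc
    rw [isSolutionOn_singleton_iff] at hx
    refine le_trans ?_ (P.energy_le hF hp.1 hu hcompl hFp hx ht hc)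
    rw [energy, le_add_iff_nonneg_right]
    exact div_nonneg (le_max_right _ _) (sq_nonneg _)

theorem lyapunovStable (P : IsSlaterProblem F g h r α z) (hF : IsMonotoneMap F)
    (hp : p ∈ SOL F (constraintSet g h)) :
    LyapunovStable (fun y => {flowField F g h α y}) p := by
  obtain ⟨b, hbc, hbp, hb⟩ := P.exists_continuous_bound hF hp
  intro ε hε
  have hev : ∀ᶠ y in 𝓝 p, b y < (1 / 2) * ε ^ 2 :=
    hbc.continuousAt.eventually (gt_mem_nhds (by rw [hbp]; positivity))
  obtain ⟨δ, hδ, hball⟩ := Metric.eventually_nhds_iff.1 hev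
  refine ⟨δ, hδ, fun T _ x hx hx0 t ht => ?_⟩
  have h1 := hb T 0 x hx t ht fun s _ => hF _ _
  have h2 := hball (show dist (x 0) p < δ by rwa [dist_eq_norm])
  exact lt_of_pow_lt_pow_left₀ 2 hε.le (by linarith)

theorem solutionsBounded (P : IsSlaterProblem F g h r α z) (hF : IsMonotoneMap F)
    (hp : p ∈ SOL F (constraintSet g h)) :
    SolutionsBounded (fun y => {flowField F g h α y}) p := by
  obtain ⟨b, hbc, -, hb⟩ := P.exists_continuous_bound hF hp
  intro ρ
  obtain ⟨B, hB⟩ := (isCompact_closedBall p ρ).exists_bound_of_continuousOn hbc.continuousOn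
  refine ⟨Real.sqrt (2 * B), fun T _ x hx hx0 t ht => Real.le_sqrt_of_sq_le ?_⟩
  have h1 := hb T 0 x hx t ht fun s _ => hF _ _
  have h2 := (le_abs_self _).trans (hB (x 0) (mem_closedBall_iff_norm.2 hx0))
  linarith

theorem globallyLyapunovStable (P : IsSlaterProblem F g h r α z) (hF : IsMonotoneMap F)
    (hp : p ∈ SOL F (constraintSet g h)) :
    GloballyLyapunovStable (safeMonotoneFlow F g h α) p := by
  have e : safeMonotoneFlow F g h α = fun y => {flowField F g h α y} :=
    funext P.safeMonotoneFlow_eq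
  rw [e]
  exact ⟨(P.flowField_eq_zero hp).symm,
    forwardComplete_of_solutionsBounded P.continuous_flowField (P.solutionsBounded hF hp),
    P.lyapunovStable hF hp, P.solutionsBounded hF hp⟩

/-- By stability it is enough that the solution enters each `δ`-ball once; outside it strong
monotonicity dissipates at rate at least `μ * δ ^ 2`. -/
theorem tendsto_of_stronglyMonotone (P : IsSlaterProblem F g h r α z) (hF : IsMonotoneMap F)
    {μ : ℝ} (hμ : 0 < μ) (hFμ : IsStronglyMonotoneMap μ F)
    (hp : p ∈ SOL F (constraintSet g h)) {x : ℝ → Vec n}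
    (hx : IsSolutionOn (fun y => {flowField F g h α y}) x (Ici 0)) :
    Tendsto x atTop (𝓝 p) := by
  rw [Metric.tendsto_atTop]
  intro ε hε
  obtain ⟨δ, hδ, hstab⟩ := P.lyapunovStable hF hp ε hε
  obtain ⟨t₀, ht₀, hxt₀⟩ : ∃ t₀, 0 ≤ t₀ ∧ ‖x t₀ - p‖ < δ := by
    by_contra! hcon
    obtain ⟨b, -, -, hb⟩ := P.exists_continuous_bound hF hp
    have hc0 : 0 < μ * δ ^ 2 := by positivity
    -- By this time the dissipated amount exceeds `b (x 0)`, which would make `½‖x t - p‖²`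
    -- negative.
    set t := (|b (x 0)| + 1) / (μ * δ ^ 2) with ht
    have ht0 : 0 ≤ t := by positivity
    have h1 := hb (t + 1) (μ * δ ^ 2) x (hx.mono Ico_subset_Ici_self) t ⟨ht0, lt_add_one t⟩
      fun s hs => by
        refine le_trans ?_ (hFμ (x s) p)
        have := hcon s hs.1
        gcongr
    have h2 : μ * δ ^ 2 * t = |b (x 0)| + 1 := by rw [ht]; field_simp
    have h3 := sq_nonneg ‖x t - p‖
    have h4 := le_abs_self (b (x 0))
    linarith
  refine ⟨t₀, fun t ht => ?_⟩
  rw [isSolutionOn_singleton_iff] at hx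
  -- The flow is autonomous, so stability applies to the solution restarted at `t₀`; the extra `1`
  -- puts `t - t₀` inside the half-open interval.
  have hshift : IsSolutionOn (fun y => {flowField F g h α y}) (fun s => x (t₀ + s))
      (Ico 0 (t - t₀ + 1)) := by
    rw [isSolutionOn_singleton_iff]
    intro s hs
    have h2 := HasDerivWithinAt.scomp s (hx (t₀ + s) (add_nonneg ht₀ hs.1))
      ((hasDerivWithinAt_id s (Ico 0 (t - t₀ + 1))).const_add t₀)
      (fun w hw => show (0 : ℝ) ≤ t₀ + id w from add_nonneg ht₀ hw.1 :
        MapsTo (fun w => t₀ + id w) (Ico 0 (t - t₀ + 1)) (Ici 0))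
    rw [one_smul] at h2
    exact h2
  have := hstab (t - t₀ + 1) (by linarith) _ hshift (by simpa using hxt₀) (t - t₀)
    ⟨by linarith, by linarith⟩
  rw [dist_eq_norm]
  simpa using this

theorem globallyAsymptoticallyStable (P : IsSlaterProblem F g h r α z) {μ : ℝ} (hμ : 0 < μ)
    (hFμ : IsStronglyMonotoneMap μ F) (hp : p ∈ SOL F (constraintSet g h)) :
    GloballyAsymptoticallyStable (safeMonotoneFlow F g h α) p := by
  have hF : IsMonotoneMap F := fun x₁ x₂ => le_trans (by positivity) (hFμ x₁ x₂)
  refine ⟨P.globallyLyapunovStable hF hp, fun x hx => ?_⟩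
  have e : safeMonotoneFlow F g h α = fun y => {flowField F g h α y} :=
    funext P.safeMonotoneFlow_eq
  rw [e] at hx
  exact P.tendsto_of_stronglyMonotone hF hμ hFμ hp hx

end IsSlaterProblem

/-! ### Affine equality constraints and the Slater point -/

/-- The `j`-th row of `H` as a vector of the Euclidean space. -/
def rowVec (H : Matrix (Fin k) (Fin n) ℝ) (j : Fin k) : Vec n := WithLp.toLp 2 (H j)

lemma affineConstraint_eq (H : Matrix (Fin k) (Fin n) ℝ) (c : Fin k → ℝ) (j : Fin k) (x : Vec n) :
    affineConstraint H c j x = inner ℝ (rowVec H j) x - c j := by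
  simp [affineConstraint, rowVec, PiLp.inner_apply, mul_comm]

lemma gradient_affineConstraint (H : Matrix (Fin k) (Fin n) ℝ) (c : Fin k → ℝ) (j : Fin k)
    (x : Vec n) : gradient (affineConstraint H c j) x = rowVec H j := by
  have e : affineConstraint H c j = fun y => inner ℝ (rowVec H j) y - c j :=
    funext (affineConstraint_eq H c j)
  refine HasGradientAt.gradient ?_
  rw [hasGradientAt_iff_hasFDerivAt, e]
  exact ((InnerProductSpace.toDual ℝ (Vec n) (rowVec H j)).hasFDerivAt).sub_const _

lemma affineConstraint_sub (H : Matrix (Fin k) (Fin n) ℝ) (c : Fin k → ℝ) (j : Fin k)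
    (x y : Vec n) :
    affineConstraint H c j y - affineConstraint H c j x = inner ℝ (rowVec H j) (y - x) := by
  rw [affineConstraint_eq, affineConstraint_eq, inner_sub_right]; ring

/-- The Mangasarian-Fromovitz condition at a feasible point yields a Slater point. -/
lemma exists_slater_of_MFCQ {g : Fin m → Vec n → ℝ} (hg : ∀ i, Differentiable ℝ (g i))
    {H : Matrix (Fin k) (Fin n) ℝ} {c : Fin k → ℝ} {x : Vec n}
    (hx : x ∈ constraintSet g (affineConstraint H c)) (hM : MFCQ g (affineConstraint H c) x) :
    ∃ z, (∀ i, g i z < 0) ∧ ∀ j, affineConstraint H c j z = 0 := by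
  obtain ⟨-, ξ, hξg, hξh⟩ := hM
  obtain ⟨s, hs⟩ := (eventually_all.2 fun i =>
    eventually_line_neg (hg i) (hx.1 i) (hξg i)).exists
  refine ⟨x + s • ξ, hs, fun j => ?_⟩
  have h1 := affineConstraint_sub H c j x (x + s • ξ)
  have h2 := hξh j
  rw [gradient_affineConstraint] at h2
  rwa [add_sub_cancel_left, real_inner_smul_right, h2, mul_zero, hx.2 j, sub_zero] at h1

end SafeMonotone

end

/-! ### The stability theorem -/

theorem mainTheorem2 {n m k : ℕ}
    (F : SafeMonotone.Vec n → SafeMonotone.Vec n)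
    (g : Fin m → SafeMonotone.Vec n → ℝ)
    (H : Matrix (Fin k) (Fin n) ℝ) (c : Fin k → ℝ) (α : ℝ)
    (hα : 0 < α)
    (hF : ContDiff ℝ 1 F)
    (hg : ∀ i, ContDiff ℝ 1 (g i))
    (hg' : ∀ i, LocallyLipschitz (gradient (g i)))
    (hconv : ∀ i, ConvexOn ℝ Set.univ (g i))
    (hMFCQ : ∀ x ∈ SafeMonotone.constraintSet g (SafeMonotone.affineConstraint H c),
      SafeMonotone.MFCQ g (SafeMonotone.affineConstraint H c) x)
    (hCR : ∀ x ∈ SafeMonotone.constraintSet g (SafeMonotone.affineConstraint H c),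
      SafeMonotone.ConstantRank g (SafeMonotone.affineConstraint H c) x) :
    (SafeMonotone.IsMonotoneMap F →
      ∀ xs ∈ SafeMonotone.SOL F
          (SafeMonotone.constraintSet g (SafeMonotone.affineConstraint H c)),
        SafeMonotone.GloballyLyapunovStable
          (SafeMonotone.safeMonotoneFlow F g (SafeMonotone.affineConstraint H c) α) xs) ∧
    (∀ μ : ℝ, 0 < μ → SafeMonotone.IsStronglyMonotoneMap μ F →
      ∀ xs ∈ SafeMonotone.SOL F
          (SafeMonotone.constraintSet g (SafeMonotone.affineConstraint H c)),
        SafeMonotone.GloballyAsymptoticallyStable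
          (SafeMonotone.safeMonotoneFlow F g (SafeMonotone.affineConstraint H c) α) xs) := by
  have hdiff : ∀ i, Differentiable ℝ (g i) := fun i => (hg i).differentiable one_ne_zero
  have hP : ∀ xs ∈ SafeMonotone.SOL F
      (SafeMonotone.constraintSet g (SafeMonotone.affineConstraint H c)),
      ∃ z, SafeMonotone.IsSlaterProblem F g (SafeMonotone.affineConstraint H c)
        (SafeMonotone.rowVec H) α z := by
    intro xs hxs
    obtain ⟨z, hzg, hzh⟩ := SafeMonotone.exists_slater_of_MFCQ hdiff hxs.1 (hMFCQ xs hxs.1)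
    exact ⟨z, hα, hF.locallyLipschitz, hdiff, hg', hconv,
      SafeMonotone.gradient_affineConstraint H c, SafeMonotone.affineConstraint_sub H c, hzg, hzh⟩
  refine ⟨fun hmono xs hxs => ?_, fun μ hμ hstrong xs hxs => ?_⟩
  · obtain ⟨z, P⟩ := hP xs hxs
    exact P.globallyLyapunovStable hmono hxs
  · obtain ⟨z, P⟩ := hP xs hxs
    exact P.globallyAsymptoticallyStable hμ hstrong hxs
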